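/- Let $(N,g)$ be a Riemannian manifold of dimension $n$ (smooth, Hausdorff, second countable, without boundary), and let $T\subset N$ be a compact embedded submanifold (without boundary) of dimension $k$, $0\le k\le n$. Let $\nu^*T\subset T^*N$ be the conormal bundle of $T$, $\theta=p\,dq$, $\omega=-d\theta=\sum_i dq^i\wedge dp_i$, $H_g(q,p)=\frac12|p|_g^2$, and let $X_{H_g}$ be given by $\omega(X_{H_g},\cdot)=dH_g$. On the space $\Omega$ of smooth paths $\gamma:[0,1]\to T^*N$ with $\gamma(0),\gamma(1)\in\nu^*T$ consider $$\mathcal A(\gamma)=-\int\gamma^*\theta+\int_0^1H_g(\gamma(t))\,dt .$$ The tangent space $T_\gamma\Omega$ consists of the smooth vector fields $\xi$ along $\gamma$ with $\xi(0),\xi(1)$ tangent to $\nu^*T$. Hamiltonian chords are the $\gamma\in\Omega$ with $\dot\gamma=X_{H_g}(\gamma)$. Let $\widehat T$ be the set of constant Hamiltonian chords. (1) $\widehat T$ is exactly the set of constant paths $\gamma_q\equiv(q,0)$ with $q\in T$. (2) The map $q\mapsto\gamma_q$ is a diffeomorphism from $T$ onto $\widehat T\subset\Omega$ (it is bijective,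 and a map $f$ from an open subset of some $\mathbb R^m$ to $T$ is smooth if and only if $(s,t)\mapsto\gamma_{f(s)}(t)$ is smooth). Moreover $\widehat T$ is Morse–Bott nondegenerate in $\Omega$: for each $q\in T$ the Hessian $d^2\mathcal A(\gamma_q)$ on $T_{\gamma_q}\Omega$ (the mixed second derivative of $\mathcal A$ along two-parameter variations of $\gamma_q$ in $\Omega$) is well defined, and $$\ker d^2\mathcal A(\gamma_q)=T_{\gamma_q}\widehat T ,$$ where $T_{\gamma_q}\widehat T$ is the space of variation fields of smooth curves in $\widehat T$ through $\gamma_q$; and $$\operatorname{Coker} d^2\mathcal A(\gamma_q)\cap (T_{\gamma_q}\widehat T)^\circ=\{0\}$$ in the space $L^2$ of square integrable vector fields along $\gamma_q$. Here the inner product of $L^2$ comes from the Sasaki metric $g\oplus g^\flat$ on $T_{(q,0)}(T^*N)=T_qN\oplus T_q^*N$, with $g^\flat$ the metric dual to $g$, and, for a pairing $P$ on $T_{(q,0)}(T^*N)$, $d^2\mathcal A(\gamma_q)$ is represented by an operator $D:T_{\gamma_q}\Omega\to L^2$ with $d^2\mathcal A(\gamma_q)(\xi_1,\xi_2)=\int_0^1P(D\xi_1,\xi_2)\,dt$,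 the cokernel is the $L^2$-orthogonal complement of the image of $D$, and $(T_{\gamma_q}\widehat T)^\circ=\{\eta\in L^2:\int_0^1P(\xi,\eta)\,dt=0\ \text{for all }\xi\in T_{\gamma_q}\widehat T\}$. The operator $D$ exists and the statement holds both for $P=\omega$ and for $P$ equal to the Sasaki metric. -/

import Mathlib

open Set Filter Topology Bundle Manifold MeasureTheory
open scoped ContDiff unitInterval

noncomputable section

namespace ConormalChords

/-! ### Paths and families of paths in a manifold -/

section Paths

variable {F : Type*} [NormedAddCommGroup F] [NormedSpace ℝ F]
  {H : Type*} [TopologicalSpace H] (J : ModelWithCorners ℝ F H)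
  {M : Type*} [TopologicalSpace M] [ChartedSpace H M]

/-- The velocity at parameter `s` of a curve `c : ℝ → M`, as a point of the tangent bundle. -/
def curveVelocity (c : ℝ → M) (s : ℝ) : TangentBundle J M :=
  ⟨c s, mfderiv 𝓘(ℝ, ℝ) J c s (1 : ℝ)⟩

/-- `v` is tangent at `x` to the subset `S`: it is the initial velocity of a smooth curve
lying in `S`.  For an embedded submanifold these vectors form the usual tangent space. -/
def IsTangentTo (S : Set M) (x : M) (v : TangentSpace J x) : Prop :=
  ∃ (c : ℝ → M) (U : Set ℝ), IsOpen U ∧ (0 : ℝ) ∈ U ∧ ContMDiffOn 𝓘(ℝ, ℝ) J ∞ c U ∧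
    (∀ s ∈ U, c s ∈ S) ∧ curveVelocity J c 0 = (⟨x, v⟩ : TangentBundle J M)

/-- A smooth path `[0,1] → M`. -/
def SmoothPath (γ : I → M) : Prop :=
  ContMDiffOn 𝓘(ℝ, ℝ) J ∞ (IccExtend (zero_le_one (α := ℝ)) γ) (Icc 0 1)

/-- A family of paths parametrised by (an open subset `U` of) a normed space `P` is smooth if it is
jointly smooth in the parameter and in time. -/
def SmoothFamilyOn {P : Type*} [NormedAddCommGroup P] [NormedSpace ℝ P]
    (U : Set P) (Γ : P → I → M) : Prop :=
  ContMDiffOn 𝓘(ℝ, P × ℝ) J ∞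
    (fun z : P × ℝ => IccExtend (zero_le_one (α := ℝ)) (Γ z.1) z.2) (U ×ˢ Icc 0 1)

/-- The velocity (one-sided at the end points) of a path `[0,1] → M`. -/
def velocity (γ : I → M) (t : I) : TangentSpace J (γ t) :=
  mfderivWithin 𝓘(ℝ, ℝ) J (IccExtend (zero_le_one (α := ℝ)) γ) (Icc 0 1) (t : ℝ) (1 : ℝ)

/-- The space of smooth paths in `M` with both end points on `L`. -/
def pathSpace (L : Set M) : Set (I → M) :=
  {γ | SmoothPath J γ ∧ γ 0 ∈ L ∧ γ 1 ∈ L}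

variable [IsManifold J ∞ M]

/-- The tangent space at `γ` of the path space: smooth vector fields along `γ` which
are tangent to `L` at both ends. -/
def pathTangent (L : Set M) (γ : I → M) : Set (∀ t, TangentSpace J (γ t)) :=
  {ξ | SmoothPath J.tangent (fun t => (⟨γ t, ξ t⟩ : TangentBundle J M)) ∧
    IsTangentTo J L (γ 0) (ξ 0) ∧ IsTangentTo J L (γ 1) (ξ 1)}


/-- The tangent space at `γ` of a family `𝓕` of paths: the variation fields of smooth curves of
paths which stay in `𝓕` and start at `γ`. -/
def familyTangent (𝓕 : Set (I → M)) (γ : I → M) : Set (∀ t, TangentSpace J (γ t)) :=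
  {ξ | ∃ (Γ : ℝ → I → M) (U : Set ℝ), IsOpen U ∧ (0 : ℝ) ∈ U ∧ SmoothFamilyOn J U Γ ∧
    (∀ s ∈ U, Γ s ∈ 𝓕) ∧
    ∀ t, curveVelocity J (fun s => Γ s t) 0 = (⟨γ t, ξ t⟩ : TangentBundle J M)}

/-- `Γ` is a smooth two-parameter variation of `γ` through paths with end points on `L`,
with variation fields `ξ₁` and `ξ₂` in the two parameter directions. -/
def IsVariation (L : Set M) (γ : I → M) (ξ₁ ξ₂ : ∀ t, TangentSpace J (γ t))
    (Γ : ℝ × ℝ → I → M) : Prop :=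
  (∃ U : Set (ℝ × ℝ), IsOpen U ∧ (0, 0) ∈ U ∧ SmoothFamilyOn J U Γ ∧
    ∀ z ∈ U, Γ z 0 ∈ L ∧ Γ z 1 ∈ L) ∧
  (∀ t, curveVelocity J (fun s => Γ (s, 0) t) 0 = (⟨γ t, ξ₁ t⟩ : TangentBundle J M)) ∧
  (∀ t, curveVelocity J (fun u => Γ (0, u) t) 0 = (⟨γ t, ξ₂ t⟩ : TangentBundle J M))

/-- `B` is the Hessian (second variation) at `γ` of the functional `A` on the space of paths with
end points on `L`: every pair of tangent vectors of the path space is realised by a two-parameter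
variation, and `B ξ₁ ξ₂` is the mixed second derivative of `A` along every such variation.
This determines `B` on the tangent space of the path space. -/
def IsHessian (A : (I → M) → ℝ) (L : Set M) (γ : I → M)
    (B : (∀ t, TangentSpace J (γ t)) → (∀ t, TangentSpace J (γ t)) → ℝ) : Prop :=
  ∀ ξ₁ ∈ pathTangent J L γ, ∀ ξ₂ ∈ pathTangent J L γ,
    (∃ Γ, IsVariation J L γ ξ₁ ξ₂ Γ) ∧
    ∀ Γ, IsVariation J L γ ξ₁ ξ₂ Γ →
      ∃ A' : ℝ → ℝ, (∀ᶠ s in 𝓝 0, HasDerivAt (fun u => A (Γ (s, u))) (A' s) 0) ∧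
        HasDerivAt A' (B ξ₁ ξ₂) 0

/-- The kernel of a Hessian `B` on the tangent space of the path space. -/
def hessianKernel (L : Set M) (γ : I → M)
    (B : (∀ t, TangentSpace J (γ t)) → (∀ t, TangentSpace J (γ t)) → ℝ) :
    Set (∀ t, TangentSpace J (γ t)) :=
  {ξ | ξ ∈ pathTangent J L γ ∧ ∀ ξ₂ ∈ pathTangent J L γ, B ξ ξ₂ = 0}

end Paths

/-! ### The cotangent bundle of a Riemannian manifold -/

/-- The model vector space `ℝⁿ`. -/
abbrev Model (n : ℕ) : Type := EuclideanSpace ℝ (Fin n)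

/-- The model vector space `ℝⁿ × (ℝⁿ)*` of the cotangent bundle. -/
abbrev CotModel (n : ℕ) : Type := Model n × (Model n →L[ℝ] ℝ)

section Cotangent

variable {n : ℕ} {N : Type*} [TopologicalSpace N] [ChartedSpace (Model n) N]
  [IsManifold (𝓡 n) ∞ N]

variable (n) in
/-- `T` is an embedded `k`-dimensional submanifold (without boundary) of `N`: near each of its
points there is a slice chart. -/
def IsSubmanifold (k : ℕ) (T : Set N) : Prop :=
  ∀ q ∈ T, ∃ φ ∈ IsManifold.maximalAtlas (𝓡 n) ∞ N, q ∈ φ.source ∧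
    ∀ y ∈ φ.source, y ∈ T ↔ ∀ i : Fin n, k ≤ (i : ℕ) → φ y i = 0

variable (n N) in
/-- The cotangent bundle `T*N`. -/
abbrev Cotangent : Type _ :=
  TotalSpace (Model n →L[ℝ] ℝ) (fun q : N => TangentSpace (𝓡 n) q →L[ℝ] Bundle.Trivial N ℝ q)

variable (n) in
/-- The model with corners of the manifold `T*N`. -/
abbrev cotI : ModelWithCorners ℝ (CotModel n) (ModelProd (Model n) (Model n →L[ℝ] ℝ)) :=
  (𝓡 n).prod 𝓘(ℝ, Model n →L[ℝ] ℝ)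

/-- The zero covector at `q`. -/
def zeroCov (q : N) : Cotangent n N := ⟨q, 0⟩

/-- The conormal bundle of `T`: covectors at points of `T` annihilating the tangent vectors
of `T`. -/
def conormal (T : Set N) : Set (Cotangent n N) :=
  {x | x.1 ∈ T ∧ ∀ v : TangentSpace (𝓡 n) x.1, IsTangentTo (𝓡 n) T x.1 v → x.2 v = 0}

/-- The Liouville form `θ = p dq`. -/
def liouville (x : Cotangent n N) (ζ : TangentSpace (cotI n) x) : ℝ :=
  x.2 (mfderiv (cotI n) (𝓡 n) (fun y : Cotangent n N => y.1) x ζ)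

/-- The canonical symplectic form `ω = -dθ = ∑ dqⁱ ∧ dpᵢ`.  The tangent space of `T*N` at `x` is
the model space `ℝⁿ × (ℝⁿ)*` read in the preferred chart of `T*N` at `x`, which is the
canonical chart `(q, p)` induced by the preferred chart of `N` at the base point. -/
def symp (x : Cotangent n N) (ζ₁ ζ₂ : TangentSpace (cotI n) x) : ℝ :=
  let a : CotModel n := ζ₁
  let b : CotModel n := ζ₂
  b.2 a.1 - a.2 b.1

/-- A smooth Riemannian metric on `N`. -/
abbrev RiemMetric (n : ℕ) (N : Type*) [TopologicalSpace N] [ChartedSpace (Model n) N]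
    [IsManifold (𝓡 n) ∞ N] : Type _ :=
  ContMDiffRiemannianMetric (𝓡 n) ∞ (Model n) (fun q : N => TangentSpace (𝓡 n) q)

variable (g : RiemMetric n N)

theorem exists_sharp (q : N) (α : TangentSpace (𝓡 n) q →L[ℝ] ℝ) :
    ∃ v : TangentSpace (𝓡 n) q, g.inner q v = α := by
  let f : Model n →ₗ[ℝ] (Model n →L[ℝ] ℝ) := (g.inner q).toLinearMap
  have hinj : Function.Injective f := by
    rw [injective_iff_map_eq_zero]
    intro v hv
    by_contra h
    have h1 := g.pos q v h
    have h2 : g.inner q v = 0 := hv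
    rw [h2] at h1
    exact lt_irrefl _ h1
  have hdim : Module.finrank ℝ (Model n) = Module.finrank ℝ (Model n →L[ℝ] ℝ) :=
    ((LinearMap.toContinuousLinearMap (𝕜 := ℝ) (E := Model n)
      (F' := ℝ)).finrank_eq.symm.trans Subspace.dual_finrank_eq).symm
  exact (LinearMap.injective_iff_surjective_of_finrank_eq_finrank hdim).1 hinj α

/-- The vector `α♯` with `g(α♯, ·) = α`. -/
def sharp (q : N) (α : TangentSpace (𝓡 n) q →L[ℝ] ℝ) : TangentSpace (𝓡 n) q :=
  Classical.choose (exists_sharp g q α)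

theorem inner_sharp (q : N) (α : TangentSpace (𝓡 n) q →L[ℝ] ℝ) :
    g.inner q (sharp g q α) = α :=
  Classical.choose_spec (exists_sharp g q α)

/-- The kinetic energy Hamiltonian `H_g(q, p) = ½ |p|²`. -/
def kinetic (x : Cotangent n N) : ℝ :=
  (1 / 2) * g.inner x.1 (sharp g x.1 x.2) (sharp g x.1 x.2)

/-- The action functional `A(γ) = -∫ γ*θ + ∫₀¹ H_g(γ(t)) dt`. -/
def action (γ : I → Cotangent n N) : ℝ :=
  -(∫ t : I, liouville (γ t) (velocity (cotI n) γ t)) + ∫ t : I, kinetic g (γ t)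

/-- The Hamiltonian chords of `H_g` attached to `L`: paths with end points on `L` satisfying
`γ' = X_H(γ)`, where the Hamiltonian vector field is given by `ω(X_H, ·) = dH`. -/
def chords (L : Set (Cotangent n N)) : Set (I → Cotangent n N) :=
  {γ | γ ∈ pathSpace (cotI n) L ∧ ∀ t, ∀ ζ : TangentSpace (cotI n) (γ t),
    symp (γ t) (velocity (cotI n) γ t) ζ =
      mfderiv (cotI n) 𝓘(ℝ, ℝ) (kinetic g) (γ t) ζ}

/-- The constant Hamiltonian chords. -/
def constChords (L : Set (Cotangent n N)) : Set (I → Cotangent n N) :=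
  {γ | γ ∈ chords g L ∧ ∃ x, ∀ t, γ t = x}

variable (n) in
/-- The constant path at the zero covector over `q`. -/
def constPath (q : N) : I → Cotangent n N := fun _ => zeroCov q

/-- `e` restricts to a diffeomorphism from the submanifold `T` onto the family `𝓕` of paths: it is
a bijection, and a map `f` from an open subset of some `ℝᵐ` to `T` is smooth iff the family
of paths `e ∘ f` is smooth. -/
def IsDiffeoOnto (T : Set N) (𝓕 : Set (I → Cotangent n N)) (e : N → I → Cotangent n N) : Prop :=
  BijOn e T 𝓕 ∧ ∀ (m : ℕ) (U : Set (Model m)) (f : Model m → N), IsOpen U → MapsTo f U T →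
    (ContMDiffOn (𝓡 m) (𝓡 n) ∞ f U ↔ SmoothFamilyOn (cotI n) U (fun s => e (f s)))

/-! ### Square integrable vector fields along a constant path at a zero covector -/

/-- The Sasaki metric at the zero covector over `q`: the orthogonal sum of `g` on the horizontal
space `T_qN` and of the dual metric on the vertical space `T_q^*N`.  The decomposition
`T_(q,0)(T*N) = T_qN × T_q^*N` is the one given by the zero section and the fibre. -/
def sasaki (q : N) (ζ₁ ζ₂ : TangentSpace (cotI n) (zeroCov (n := n) q)) : ℝ :=
  let a : CotModel n := ζ₁
  let b : CotModel n := ζ₂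
  g.inner q a.1 b.1 + g.inner q (sharp g q a.2) (sharp g q b.2)

/-- Square integrable vector fields along `constPath n q`, modulo equality almost everywhere;
the fibre `T_(q,0)(T*N)` does not depend on time. -/
abbrev L2Fields (n : ℕ) : Type := Lp (CotModel n) 2 (volume : Measure I)

/-- Vector fields along `constPath n q`. -/
abbrev Fields (n : ℕ) {N : Type*} [TopologicalSpace N] [ChartedSpace (Model n) N]
    [IsManifold (𝓡 n) ∞ N] (q : N) : Type :=
  ∀ t : I, TangentSpace (cotI n) (constPath n q t)

/-- The operator `D`, from the tangent space of the path space to `L²`, represents the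
Hessian `B` at `constPath n q` through the pairing `P`: `B(ξ₁, ξ₂) = ∫₀¹ P(D ξ₁(t), ξ₂(t)) dt`. -/
def Represents (L : Set (Cotangent n N)) (q : N)
    (P : TangentSpace (cotI n) (zeroCov (n := n) q) →
      TangentSpace (cotI n) (zeroCov (n := n) q) → ℝ)
    (B : Fields n q → Fields n q → ℝ) (D : Fields n q → L2Fields n) : Prop :=
  ∀ ξ₁ ∈ pathTangent (cotI n) L (constPath n q), ∀ ξ₂ ∈ pathTangent (cotI n) L (constPath n q),
    B ξ₁ ξ₂ = ∫ t : I, P (D ξ₁ t) (ξ₂ t)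

/-- The `L²`-cokernel of an operator `D` on the tangent space of the path space: the orthogonal
complement of its image in `L²`. -/
def cokernel (L : Set (Cotangent n N)) (q : N) (D : Fields n q → L2Fields n) :
    Set (L2Fields n) :=
  {η | ∀ ξ ∈ pathTangent (cotI n) L (constPath n q), ∫ t : I, sasaki g q (D ξ t) (η t) = 0}

/-- The annihilator in `L²` of a set `V` of vector fields, with respect to the pairing `∫ P`. -/
def annihilator (q : N)
    (P : TangentSpace (cotI n) (zeroCov (n := n) q) →
      TangentSpace (cotI n) (zeroCov (n := n) q) → ℝ)
    (V : Set (Fields n q)) : Set (L2Fields n) :=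
  {η | ∀ ξ ∈ V, ∫ t : I, P (ξ t) (η t) = 0}

/-- Nondegeneracy of the action functional along the family `𝓕` of critical paths at the member
`constPath n q`: the Hessian exists, its kernel is the tangent space of `𝓕`, and the cokernel of
the operator representing the Hessian meets the annihilator of the tangent space of `𝓕`
trivially.  The last condition is required both when the Hessian is represented, and the
annihilator is taken, through the symplectic form (the operator is then, up to sign, the
linearisation of `γ' - X_H(γ)`), and through the Sasaki metric. -/
def IsBottNondegenerateAt (L : Set (Cotangent n N)) (𝓕 : Set (I → Cotangent n N)) (q : N) :
    Prop :=
  ∃ B : Fields n q → Fields n q → ℝ,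
    IsHessian (cotI n) (action g) L (constPath n q) B ∧
    hessianKernel (cotI n) L (constPath n q) B = familyTangent (cotI n) 𝓕 (constPath n q) ∧
    (∃ D : Fields n q → L2Fields n, Represents L q (symp (zeroCov q)) B D ∧
      cokernel g L q D ∩
        annihilator q (symp (zeroCov q)) (familyTangent (cotI n) 𝓕 (constPath n q)) = {0}) ∧
    (∃ D : Fields n q → L2Fields n, Represents L q (sasaki g q) B D ∧
      cokernel g L q D ∩
        annihilator q (sasaki g q) (familyTangent (cotI n) 𝓕 (constPath n q)) = {0})

end Cotangent

end ConormalChords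

end

open ConormalChords


/-!
A constant path at `x` is a chord of `H_g` iff `dH_g(x) = 0`, and since `H_g(q, r p) = r² H_g(q, p)`
this happens only on the zero section.

In a chart of `N` flattening `T`, with tangent space `V`, and in the induced canonical coordinates
of `T*N`, the fields `ξ = (a, b)` along `γ_q` with conormal end points are those with
`a(0), a(1) ∈ V` and `b(0), b(1)` vanishing on `V`, and the Hessian is
`∫ (-(b₁ a₂' + b₂ a₁') + g♭(b₁, b₂))`.  The end conditions kill the boundary term of an integration
by parts, so the Hessian is represented through the Sasaki metric by `D(a, b) = (b'♯, b - g a')`.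

If `D(a, b) = 0`, then `b` is constant and `a' = b♯`, so `b♯ = a(1) - a(0)` lies in `V`, which `b`
annihilates: hence `b = 0` and `a ∈ V` is constant.  Conversely `D ζ = f` is solved by integrating
twice, up to a constant field `(τ, 0)` with `τ ∈ V`; so an `η` orthogonal to the image of `D` and to
the constant fields in `V` is orthogonal to all smooth fields.
-/

noncomputable section

namespace ConormalChords

/-! ### Calculus on cylinders `U × [0,1]` -/

theorem exists_isOpen_mapsTo_prod {X Y Z : Type*} [TopologicalSpace X] [TopologicalSpace Y]
    [TopologicalSpace Z] {K : Set Y} (hK : IsCompact K) {U : Set X} (hU : IsOpen U) {z₀ : X}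
    (hz₀ : z₀ ∈ U) {F : X × Y → Z} (hF : ContinuousOn F (U ×ˢ K)) {O : Set Z} (hO : IsOpen O)
    (hF₀ : ∀ t ∈ K, F (z₀, t) ∈ O) :
    ∃ U', IsOpen U' ∧ z₀ ∈ U' ∧ U' ⊆ U ∧ MapsTo F (U' ×ˢ K) O := by
  have hnear : ∀ᶠ z in 𝓝 z₀, ∀ t ∈ K, z ∈ U ∧ (t ∈ K → F (z, t) ∈ O) := by
    refine hK.eventually_forall_of_forall_eventually fun t ht => ?_
    have hmaps := (hF (z₀, t) ⟨hz₀, ht⟩).preimage_mem_nhdsWithin (hO.mem_nhds (hF₀ t ht))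
    filter_upwards [mem_nhdsWithin_iff_eventually.1 hmaps,
      (hU.preimage continuous_fst).mem_nhds (show (z₀, t).1 ∈ U from hz₀)] with z hz hzU
    exact ⟨hzU, fun hzK => hz ⟨hzU, hzK⟩⟩
  obtain ⟨U', hU', hopen, hmem⟩ := eventually_nhds_iff.1 (hnear.and (hU.mem_nhds hz₀))
  exact ⟨U', hopen, hmem, fun z hz => (hU' z hz).2,
    fun z hz => ((hU' z.1 hz.1).1 z.2 hz.2).2 hz.2⟩

section Cylinder

theorem continuous_slice {E W : Type*} [TopologicalSpace E] [TopologicalSpace W] {U : Set E}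
    {F : E × ℝ → W} (hF : ContinuousOn F (U ×ˢ Icc 0 1)) {z : E} (hz : z ∈ U) :
    Continuous fun t : I => F (z, t) :=
  hF.comp_continuous (by fun_prop) fun t => ⟨hz, t.2⟩

variable {E W : Type*} [NormedAddCommGroup E] [NormedSpace ℝ E]
  [NormedAddCommGroup W] [NormedSpace ℝ W] {U : Set E}

/-- The derivative in the direction `v` of a function on the cylinder `U × [0,1]`; the time
derivative is one-sided at the ends of the interval. -/
def cylDeriv (U : Set E) (v : E × ℝ) (F : E × ℝ → W) (p : E × ℝ) : W :=
  fderivWithin ℝ F (U ×ˢ Icc 0 1) p v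

theorem uniqueDiffOn_cylinder (hU : IsOpen U) : UniqueDiffOn ℝ (U ×ˢ Icc (0 : ℝ) 1) :=
  hU.uniqueDiffOn.prod (uniqueDiffOn_Icc zero_lt_one)

theorem cylDeriv_eq_of_hasFDerivWithinAt (hU : IsOpen U) {F : E × ℝ → W} {p : E × ℝ}
    (hp : p ∈ U ×ˢ Icc (0 : ℝ) 1) {F' : E × ℝ →L[ℝ] W}
    (h : HasFDerivWithinAt F F' (U ×ˢ Icc 0 1) p) (v : E × ℝ) : cylDeriv U v F p = F' v := by
  rw [cylDeriv, h.fderivWithin (uniqueDiffOn_cylinder hU p hp)]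

theorem contDiffOn_cylDeriv (hU : IsOpen U) {F : E × ℝ → W}
    (hF : ContDiffOn ℝ ∞ F (U ×ˢ Icc 0 1)) (v : E × ℝ) :
    ContDiffOn ℝ ∞ (cylDeriv U v F) (U ×ˢ Icc 0 1) :=
  (hF.fderivWithin (uniqueDiffOn_cylinder hU) (by simp)).clm_apply contDiffOn_const

theorem cylDeriv_congr {F G : E × ℝ → W} (h : EqOn F G (U ×ˢ Icc 0 1)) {p : E × ℝ}
    (hp : p ∈ U ×ˢ Icc (0 : ℝ) 1) (v : E × ℝ) : cylDeriv U v F p = cylDeriv U v G p := by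
  rw [cylDeriv, fderivWithin_congr h (h hp), cylDeriv]

theorem cylDeriv_clm_apply {W' : Type*} [NormedAddCommGroup W'] [NormedSpace ℝ W']
    (hU : IsOpen U) {f : E × ℝ → W →L[ℝ] W'} {g : E × ℝ → W}
    (hf : ContDiffOn ℝ ∞ f (U ×ˢ Icc 0 1)) (hg : ContDiffOn ℝ ∞ g (U ×ˢ Icc 0 1)) (v : E × ℝ)
    {p : E × ℝ} (hp : p ∈ U ×ˢ Icc (0 : ℝ) 1) :
    cylDeriv U v (fun p => f p (g p)) p =
      f p (cylDeriv U v g p) + cylDeriv U v f p (g p) := by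
  have hfp := (hf.differentiableOn (by simp) p hp).hasFDerivWithinAt
  have hgp := (hg.differentiableOn (by simp) p hp).hasFDerivWithinAt
  rw [cylDeriv_eq_of_hasFDerivWithinAt hU hp (hfp.clm_apply hgp)]
  simp [cylDeriv]

theorem cylDeriv_add (hU : IsOpen U) {F G : E × ℝ → W}
    (hF : ContDiffOn ℝ ∞ F (U ×ˢ Icc 0 1)) (hG : ContDiffOn ℝ ∞ G (U ×ˢ Icc 0 1)) (v : E × ℝ)
    {p : E × ℝ} (hp : p ∈ U ×ˢ Icc (0 : ℝ) 1) :
    cylDeriv U v (fun p => F p + G p) p = cylDeriv U v F p + cylDeriv U v G p := by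
  have hFp := (hF.differentiableOn (by simp) p hp).hasFDerivWithinAt
  have hGp := (hG.differentiableOn (by simp) p hp).hasFDerivWithinAt
  exact cylDeriv_eq_of_hasFDerivWithinAt hU hp (hFp.fun_add hGp) v

/-- At parameters where both factors vanish, only the products of first derivatives survive. -/
theorem cylDeriv_cylDeriv_clm_apply_of_eq_zero (hU : IsOpen U) {f : E × ℝ → W →L[ℝ] ℝ}
    {g : E × ℝ → W} (hf : ContDiffOn ℝ ∞ f (U ×ˢ Icc 0 1))
    (hg : ContDiffOn ℝ ∞ g (U ×ˢ Icc 0 1)) (v w : E × ℝ) {p : E × ℝ}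
    (hp : p ∈ U ×ˢ Icc (0 : ℝ) 1) (hf0 : f p = 0) (hg0 : g p = 0) :
    cylDeriv U w (cylDeriv U v fun p => f p (g p)) p =
      cylDeriv U w f p (cylDeriv U v g p) + cylDeriv U v f p (cylDeriv U w g p) := by
  have hf' := contDiffOn_cylDeriv hU hf v
  have hg' := contDiffOn_cylDeriv hU hg v
  rw [cylDeriv_congr (fun q hq => cylDeriv_clm_apply hU hf hg v hq) hp,
    cylDeriv_add hU (hf.clm_apply hg') (hf'.clm_apply hg) w hp,
    cylDeriv_clm_apply hU hf hg' w hp, cylDeriv_clm_apply hU hf' hg w hp]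
  simp [hf0, hg0]

theorem cylDeriv_cylDeriv_eq (hU : IsOpen U) {F : E × ℝ → W}
    (hF : ContDiffOn ℝ ∞ F (U ×ˢ Icc 0 1)) {p : E × ℝ} (hp : p ∈ U ×ˢ Icc (0 : ℝ) 1)
    (v w : E × ℝ) :
    cylDeriv U w (cylDeriv U v F) p =
      fderivWithin ℝ (fderivWithin ℝ F (U ×ˢ Icc 0 1)) (U ×ˢ Icc 0 1) p w v := by
  have hd : ContDiffOn ℝ ∞ (fderivWithin ℝ F (U ×ˢ Icc 0 1)) (U ×ˢ Icc 0 1) :=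
    hF.fderivWithin (uniqueDiffOn_cylinder hU) (by simp)
  have hdp := (hd.differentiableOn (by simp) p hp).hasFDerivWithinAt
  refine (cylDeriv_eq_of_hasFDerivWithinAt hU hp
    (hdp.clm_apply (hasFDerivWithinAt_const v p (U ×ˢ Icc (0 : ℝ) 1))) w).trans ?_
  simp

theorem cylDeriv_comm (hU : IsOpen U) {F : E × ℝ → W}
    (hF : ContDiffOn ℝ ∞ F (U ×ˢ Icc 0 1)) {p : E × ℝ} (hp : p ∈ U ×ˢ Icc (0 : ℝ) 1)
    (v w : E × ℝ) :
    cylDeriv U w (cylDeriv U v F) p = cylDeriv U v (cylDeriv U w F) p := by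
  have hcl : p ∈ closure (interior (U ×ˢ Icc (0 : ℝ) 1)) := by
    rw [interior_prod_eq, closure_prod_eq, interior_Icc, closure_Ioo zero_ne_one,
      hU.interior_eq]
    exact ⟨subset_closure hp.1, hp.2⟩
  have htwo : (2 : ℕ∞ω) ≤ ∞ := WithTop.coe_le_coe.2 le_top
  have hsymm : IsSymmSndFDerivWithinAt ℝ F (U ×ˢ Icc 0 1) p :=
    (hF p hp).isSymmSndFDerivWithinAt (by simpa using htwo)
      (uniqueDiffOn_cylinder hU) hcl hp
  rw [cylDeriv_cylDeriv_eq hU hF hp, cylDeriv_cylDeriv_eq hU hF hp]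
  exact hsymm _ _

theorem hasDerivAt_cylDeriv (hU : IsOpen U) {F : E × ℝ → W} {t : ℝ} (ht : t ∈ Icc (0 : ℝ) 1)
    (e z : E) {s : ℝ} (hz : z + s • e ∈ U)
    (hF : DifferentiableWithinAt ℝ F (U ×ˢ Icc 0 1) (z + s • e, t)) :
    HasDerivAt (fun s : ℝ => F (z + s • e, t)) (cylDeriv U (e, 0) F (z + s • e, t)) s := by
  have hline : HasDerivAt (fun s : ℝ => (z + s • e, t)) (e, (0 : ℝ)) s := by
    have hs : HasDerivAt (fun s : ℝ => z + s • e) e s := by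
      simpa using ((hasDerivAt_id s).smul_const e).const_add z
    exact hs.prodMk (hasDerivAt_const s t)
  have hmem : (fun r : ℝ => (z + r • e, t)) ⁻¹' (U ×ˢ Icc 0 1) ∈ 𝓝 s := by
    have hc : ContinuousAt (fun r : ℝ => z + r • e) s := by fun_prop
    filter_upwards [hc.preimage_mem_nhds (hU.mem_nhds hz)] with r hr using ⟨hr, ht⟩
  exact (hF.hasFDerivWithinAt.comp_hasDerivWithinAt s hline.hasDerivWithinAt
    (mapsTo_preimage _ _)).hasDerivAt hmem

theorem hasDerivAt_integral_slice (hU : IsOpen U) {F : E × ℝ → ℝ}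
    (hF : ContDiffOn ℝ ∞ F (U ×ˢ Icc 0 1)) {z : E} (hz : z ∈ U) (e : E) :
    HasDerivAt (fun s : ℝ => ∫ t : I, F (z + s • e, t))
      (∫ t : I, cylDeriv U (e, 0) F (z, t)) 0 := by
  have hc : Continuous fun s : ℝ => z + s • e := by fun_prop
  have hz0 : z + (0 : ℝ) • e ∈ U := by simpa using hz
  have hnhds : (fun s : ℝ => z + s • e) ⁻¹' U ∈ 𝓝 (0 : ℝ) :=
    hc.continuousAt.preimage_mem_nhds (hU.mem_nhds hz0)
  obtain ⟨δ, hδ, hδU⟩ := Metric.nhds_basis_closedBall.mem_iff.1 hnhds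
  have hF' := (contDiffOn_cylDeriv hU hF (e, 0)).continuousOn
  have hcompact : IsCompact (Metric.closedBall (0 : ℝ) δ ×ˢ Icc (0 : ℝ) 1) :=
    (isCompact_closedBall _ _).prod isCompact_Icc
  obtain ⟨C, hC⟩ := hcompact.exists_bound_of_continuousOn
    (hF'.comp (f := fun p : ℝ × ℝ => (z + p.1 • e, p.2)) (by fun_prop)
      fun p hp => ⟨hδU hp.1, hp.2⟩)
  have key := (hasDerivAt_integral_of_dominated_loc_of_deriv_le (μ := (volume : Measure I))
    (F := fun s (t : I) => F (z + s • e, t)) (bound := fun _ => C)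
    (F' := fun s (t : I) => cylDeriv U (e, 0) F (z + s • e, t))
    (Metric.closedBall_mem_nhds _ hδ)
    (eventually_of_mem hnhds fun s hs =>
      (continuous_slice hF.continuousOn hs).aestronglyMeasurable)
    ((continuous_slice hF.continuousOn hz0).integrable_of_hasCompactSupport
      (HasCompactSupport.of_compactSpace _))
    (continuous_slice hF' hz0).aestronglyMeasurable
    (ae_of_all _ fun t s hs => hC (s, t) ⟨hs, t.2⟩)
    (integrable_const _)
    (ae_of_all _ fun t s hs => hasDerivAt_cylDeriv hU t.2 e z (hδU hs)
      (hF.differentiableOn (by simp) _ ⟨hδU hs, t.2⟩))).2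
  simpa using key

end Cylinder

section MixedDerivative

/-- `b` is the mixed second derivative `∂ₛ∂ᵤ f` at the origin. -/
def HasMixedDeriv (f : ℝ × ℝ → ℝ) (b : ℝ) : Prop :=
  ∃ f' : ℝ → ℝ, (∀ᶠ s in 𝓝 0, HasDerivAt (fun u => f (s, u)) (f' s) 0) ∧ HasDerivAt f' b 0

theorem HasMixedDeriv.neg {f : ℝ × ℝ → ℝ} {b : ℝ} (hf : HasMixedDeriv f b) :
    HasMixedDeriv (fun z => -f z) (-b) :=
  let ⟨f', hf', hb⟩ := hf
  ⟨fun s => -f' s, hf'.mono fun _ h => h.fun_neg, hb.fun_neg⟩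

theorem HasMixedDeriv.add {f₁ f₂ : ℝ × ℝ → ℝ} {b₁ b₂ : ℝ} (h₁ : HasMixedDeriv f₁ b₁)
    (h₂ : HasMixedDeriv f₂ b₂) : HasMixedDeriv (fun z => f₁ z + f₂ z) (b₁ + b₂) :=
  let ⟨f₁', hf₁, hb₁⟩ := h₁
  let ⟨f₂', hf₂, hb₂⟩ := h₂
  ⟨fun s => f₁' s + f₂' s, by filter_upwards [hf₁, hf₂] with s h h' using h.fun_add h',
    hb₁.fun_add hb₂⟩

theorem HasMixedDeriv.congr {f f₁ : ℝ × ℝ → ℝ} {b : ℝ} (h : HasMixedDeriv f b)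
    (hf : f₁ =ᶠ[𝓝 0] f) : HasMixedDeriv f₁ b := by
  obtain ⟨f', hf', hb⟩ := h
  refine ⟨f', ?_, hb⟩
  have hline : ∀ᶠ s : ℝ in 𝓝 0, f₁ =ᶠ[𝓝 (s, 0)] f :=
    (show ContinuousAt (fun s : ℝ => (s, (0 : ℝ))) 0 by fun_prop).tendsto.eventually
      hf.eventually_nhds
  filter_upwards [hf', hline] with s hs hs'
  exact hs.congr_of_eventuallyEq
    ((show ContinuousAt (fun u : ℝ => (s, u)) 0 by fun_prop).tendsto.eventually hs')

variable {U : Set (ℝ × ℝ)}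

theorem HasMixedDeriv.congr_value {f : ℝ × ℝ → ℝ} {b b' : ℝ} (h : HasMixedDeriv f b)
    (hb : b = b') : HasMixedDeriv f b' :=
  hb ▸ h

theorem hasMixedDeriv_integral (hU : IsOpen U) (h0 : (0 : ℝ × ℝ) ∈ U) {F : (ℝ × ℝ) × ℝ → ℝ}
    (hF : ContDiffOn ℝ ∞ F (U ×ˢ Icc 0 1)) :
    HasMixedDeriv (fun z => ∫ t : I, F (z, t))
      (∫ t : I, cylDeriv U ((1, 0), 0) (cylDeriv U ((0, 1), 0) F) (0, t)) := by
  refine ⟨fun s => ∫ t : I, cylDeriv U ((0, 1), 0) F ((s, 0), t), ?_, ?_⟩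
  · have hc : Continuous fun s : ℝ => (s, (0 : ℝ)) := by fun_prop
    filter_upwards [hc.continuousAt.preimage_mem_nhds (hU.mem_nhds h0)] with s hs
    simpa using hasDerivAt_integral_slice hU hF hs (0, 1)
  · simpa using hasDerivAt_integral_slice hU (contDiffOn_cylDeriv hU hF ((0, 1), 0)) h0 (1, 0)

theorem hasMixedDeriv_integral_pairing {W : Type*} [NormedAddCommGroup W] [NormedSpace ℝ W]
    (hU : IsOpen U) (h0 : (0 : ℝ × ℝ) ∈ U) {f : (ℝ × ℝ) × ℝ → W →L[ℝ] ℝ}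
    {g : (ℝ × ℝ) × ℝ → W} (hf : ContDiffOn ℝ ∞ f (U ×ˢ Icc 0 1))
    (hg : ContDiffOn ℝ ∞ g (U ×ˢ Icc 0 1)) (hf0 : ∀ t : I, f (0, t) = 0)
    (hg0 : ∀ t : I, g (0, t) = 0) :
    HasMixedDeriv (fun z => ∫ t : I, f (z, t) (g (z, t)))
      (∫ t : I, (cylDeriv U ((1, 0), 0) f (0, t) (cylDeriv U ((0, 1), 0) g (0, t)) +
        cylDeriv U ((0, 1), 0) f (0, t) (cylDeriv U ((1, 0), 0) g (0, t)))) := by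
  convert hasMixedDeriv_integral hU h0 (hf.clm_apply hg) using 3 with t
  exact (cylDeriv_cylDeriv_clm_apply_of_eq_zero hU hf hg _ _ ⟨h0, t.2⟩ (hf0 t) (hg0 t)).symm

end MixedDerivative

/-! ### The linear model of the second variation -/

section UnitInterval

variable {W : Type*} [NormedAddCommGroup W] [NormedSpace ℝ W]

/-- The derivative along `[0,1]`, one-sided at the end points. -/
abbrev dt (f : ℝ → W) (t : ℝ) : W :=
  derivWithin f (Icc (0 : ℝ) 1) t

theorem contDiffOn_dt {f : ℝ → W} (hf : ContDiffOn ℝ ∞ f (Icc 0 1)) :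
    ContDiffOn ℝ ∞ (dt f) (Icc 0 1) :=
  hf.derivWithin (uniqueDiffOn_Icc zero_lt_one) (by simp)

theorem hasDerivWithinAt_dt {f : ℝ → W} (hf : ContDiffOn ℝ ∞ f (Icc 0 1)) (t : I) :
    HasDerivWithinAt f (dt f t) (Icc 0 1) t :=
  (hf.differentiableOn (by simp) t t.2).hasDerivWithinAt

theorem dt_eq_of_hasDerivWithinAt {f : ℝ → W} {f' : W} {t : I}
    (h : HasDerivWithinAt f f' (Icc 0 1) t) : dt f t = f' :=
  h.derivWithin (uniqueDiffOn_Icc zero_lt_one t t.2)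

theorem eq_of_dt_eq_zero {f : ℝ → W} (hf : ContDiffOn ℝ ∞ f (Icc 0 1))
    (h : ∀ t : I, dt f t = 0) (t : I) : f t = f 0 :=
  constant_of_derivWithin_zero (hf.differentiableOn (by simp))
    (fun s hs => h ⟨s, Ico_subset_Icc_self hs⟩) t t.2

theorem integrable_of_contDiffOn {f : ℝ → W} (hf : ContDiffOn ℝ ∞ f (Icc 0 1)) :
    Integrable fun t : I => f t :=
  (hf.continuousOn.comp_continuous continuous_subtype_val
    Subtype.property).integrable_of_hasCompactSupport (HasCompactSupport.of_compactSpace _)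

theorem integral_dt [CompleteSpace W] {f : ℝ → W} (hf : ContDiffOn ℝ ∞ f (Icc 0 1)) :
    ∫ t : I, dt f t = f 1 - f 0 := by
  rw [integral_subtype measurableSet_Icc (dt f), integral_Icc_eq_integral_Ioc,
    ← intervalIntegral.integral_of_le zero_le_one]
  refine intervalIntegral.integral_eq_sub_of_hasDerivAt_of_le zero_le_one hf.continuousOn
    (fun t ht => (hasDerivWithinAt_dt hf ⟨t, Ioo_subset_Icc_self ht⟩).hasDerivAt
      (Icc_mem_nhds ht.1 ht.2)) ?_
  rw [intervalIntegrable_iff_integrableOn_Icc_of_le zero_le_one]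
  exact (contDiffOn_dt hf).continuousOn.integrableOn_Icc

theorem exists_primitive [CompleteSpace W] {f : ℝ → W} (hf : ContDiff ℝ ∞ f) :
    ∃ F : ℝ → W, ContDiff ℝ ∞ F ∧ (∀ t, HasDerivAt F (f t) t) ∧ F 0 = 0 := by
  have hd : ∀ t, HasDerivAt (fun t => ∫ s in (0 : ℝ)..t, f s) (f t) t := fun t =>
    intervalIntegral.integral_hasDerivAt_right (hf.continuous.intervalIntegrable _ _)
      (hf.continuous.stronglyMeasurableAtFilter _ _) hf.continuous.continuousAt
  refine ⟨fun t => ∫ s in (0 : ℝ)..t, f s, ?_, hd, by simp⟩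
  rw [contDiff_infty_iff_deriv, show deriv _ = f from funext fun t => (hd t).deriv]
  exact ⟨fun t => (hd t).differentiableAt, hf⟩

theorem eq_zero_of_integral_mul_one_sub_mul_eq_zero {f : ℝ → ℝ}
    (hf : ContDiffOn ℝ ∞ f (Icc 0 1)) (hnonneg : ∀ t, 0 ≤ f t)
    (h : ∫ t : I, (t * (1 - t) : ℝ) * f t = 0) (t : I) : f t = 0 := by
  have hcont : ContinuousOn (fun t => t * (1 - t) * f t) (Icc 0 1) :=
    (by fun_prop : Continuous fun t : ℝ => t * (1 - t)).continuousOn.mul hf.continuousOn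
  rw [integral_subtype measurableSet_Icc fun t => t * (1 - t) * f t] at h
  have hae := (setIntegral_eq_zero_iff_of_nonneg_ae
    (ae_restrict_of_forall_mem measurableSet_Icc fun t ht =>
      mul_nonneg (mul_nonneg ht.1 (sub_nonneg.2 ht.2)) (hnonneg t)) hcont.integrableOn_Icc).1 h
  have hprod := Measure.eqOn_Icc_of_ae_eq volume zero_ne_one hae hcont continuousOn_const
  have hIoo : EqOn f 0 (Ioo 0 1) := fun s hs => by
    have hweight : s * (1 - s) ≠ 0 := mul_ne_zero hs.1.ne' (sub_pos.2 hs.2).ne'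
    exact (mul_eq_zero_iff_left hweight).1 (hprod (Ioo_subset_Icc_self hs))
  exact hIoo.of_subset_closure hf.continuousOn continuousOn_const Ioo_subset_Icc_self
    (by rw [closure_Ioo zero_ne_one]) t.2

theorem integrable_continuous_smul {η : I → W} (hη : Integrable η) {ψ : ℝ → ℝ}
    (hψ : Continuous ψ) : Integrable fun t : I => ψ t • η t := by
  have hψI : Continuous fun t : I => ψ t := hψ.comp continuous_subtype_val
  obtain ⟨C, hC⟩ := isCompact_univ.exists_bound_of_continuousOn hψI.continuousOn
  exact hη.bdd_smul C hψI.aestronglyMeasurable (ae_of_all _ fun t => hC t (mem_univ t))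

theorem ae_eq_zero_of_forall_integral_smul_eq_zero [CompleteSpace W] {η : I → W}
    (hη : Integrable η) (h : ∀ ψ : ℝ → ℝ, ContDiff ℝ ∞ ψ → ∫ t : I, ψ t • η t = 0) :
    η =ᵐ[volume] 0 := by
  have hemb : MeasurableEmbedding ((↑) : I → ℝ) := .subtype_coe measurableSet_Icc
  have hext : IccExtend (zero_le_one (α := ℝ)) η ∘ ((↑) : I → ℝ) = η :=
    funext fun t => IccExtend_val _ _ t
  have hint : Integrable (IccExtend (zero_le_one (α := ℝ)) η) (volume.map ((↑) : I → ℝ)) := by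
    rwa [hemb.integrable_map_iff, hext]
  have hae : ∀ᵐ t ∂volume.map ((↑) : I → ℝ), IccExtend (zero_le_one (α := ℝ)) η t = 0 := by
    refine ae_eq_zero_of_integral_contDiff_smul_eq_zero hint.locallyIntegrable fun ψ hψ _ => ?_
    simpa [hemb.integral_map] using h ψ hψ
  filter_upwards [hemb.ae_map_iff.1 hae] with t ht
  simpa using ht

end UnitInterval

section LinearModel

variable {E : Type*} [NormedAddCommGroup E] [NormedSpace ℝ E]

/-- The conormal space `V × V⁰` of a linear subspace `V`. -/
def linConormal (V : Submodule ℝ E) : Submodule ℝ (E × (E →L[ℝ] ℝ)) where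
  carrier := {z | z.1 ∈ V ∧ ∀ v ∈ V, z.2 v = 0}
  add_mem' := fun ⟨hx, hα⟩ ⟨hy, hβ⟩ =>
    ⟨V.add_mem hx hy, fun v hv => by simp [hα v hv, hβ v hv]⟩
  zero_mem' := ⟨V.zero_mem, fun _ _ => rfl⟩
  smul_mem' := fun c _ ⟨hx, hα⟩ => ⟨V.smul_mem c hx, fun v hv => by simp [hα v hv]⟩

/-- Smooth fields along `[0,1]` whose end points lie in `W`: the coordinate expression of a tangent
vector, at a constant path, of the space of paths with end points on a submanifold. -/
def IsAdmissible {F : Type*} [NormedAddCommGroup F] [NormedSpace ℝ F] (W : Submodule ℝ F)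
    (ζ : ℝ → F) : Prop :=
  ContDiffOn ℝ ∞ ζ (Icc 0 1) ∧ ζ 0 ∈ W ∧ ζ 1 ∈ W

/-- `G`, sending `v` to the functional `⟨v, ·⟩`, comes from a scalar product.  Its inverse is the
sharp map. -/
structure IsScalarProduct (G : E ≃L[ℝ] (E →L[ℝ] ℝ)) : Prop where
  symm : ∀ v w, G v w = G w v
  pos : ∀ v, v ≠ 0 → 0 < G v v

/-- The Sasaki metric: the orthogonal sum of `G` and its dual metric. -/
def linSasaki (G : E ≃L[ℝ] (E →L[ℝ] ℝ)) (x : E × (E →L[ℝ] ℝ)) : E × (E →L[ℝ] ℝ) →L[ℝ] ℝ :=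
  (G x.1).coprod (x.2 ∘L (G.symm : (E →L[ℝ] ℝ) →L[ℝ] E))

/-- The second variation of the action in canonical coordinates. -/
def linHess (G : E ≃L[ℝ] (E →L[ℝ] ℝ)) (ζ₁ ζ₂ : ℝ → E × (E →L[ℝ] ℝ)) : ℝ :=
  ∫ t : I, (-((ζ₁ t).2 (dt ζ₂ t).1 + (ζ₂ t).2 (dt ζ₁ t).1) + (ζ₁ t).2 (G.symm (ζ₂ t).2))

/-- The operator representing the second variation through the Sasaki metric. -/
def hessOp (G : E ≃L[ℝ] (E →L[ℝ] ℝ)) (ζ : ℝ → E × (E →L[ℝ] ℝ)) (t : ℝ) : E × (E →L[ℝ] ℝ) :=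
  (G.symm (dt ζ t).2, (ζ t).2 - G (dt ζ t).1)

variable {G : E ≃L[ℝ] (E →L[ℝ] ℝ)} {V : Submodule ℝ E}

theorem linSasaki_apply (x y : E × (E →L[ℝ] ℝ)) :
    linSasaki G x y = G x.1 y.1 + x.2 (G.symm y.2) := by
  simp [linSasaki]

theorem linSasaki_smul (c : ℝ) (x y : E × (E →L[ℝ] ℝ)) :
    linSasaki G (c • x) y = c * linSasaki G x y := by
  simp [linSasaki_apply, mul_add]

namespace IsScalarProduct

theorem eq_zero (h : IsScalarProduct G) {v : E} (hv : G v v = 0) : v = 0 :=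
  of_not_not fun hne => (h.pos v hne).ne' hv

theorem nonneg (h : IsScalarProduct G) (v : E) : 0 ≤ G v v := by
  rcases eq_or_ne v 0 with rfl | hv
  · simp
  · exact (h.pos v hv).le

theorem apply_symm_comm (h : IsScalarProduct G) (α β : E →L[ℝ] ℝ) :
    α (G.symm β) = β (G.symm α) := by
  simpa using h.symm (G.symm α) (G.symm β)

theorem apply_symm_self_nonneg (h : IsScalarProduct G) (α : E →L[ℝ] ℝ) : 0 ≤ α (G.symm α) := by
  simpa using h.nonneg (G.symm α)

theorem eq_zero_of_apply_symm_self (h : IsScalarProduct G) {α : E →L[ℝ] ℝ}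
    (hα : α (G.symm α) = 0) : α = 0 := by
  have hsharp : G.symm α = 0 := h.eq_zero (by simpa using hα)
  simpa using hsharp

theorem linSasaki_self_nonneg (h : IsScalarProduct G) (x : E × (E →L[ℝ] ℝ)) :
    0 ≤ linSasaki G x x := by
  simpa only [linSasaki_apply] using add_nonneg (h.nonneg x.1) (h.apply_symm_self_nonneg x.2)

theorem eq_zero_of_linSasaki_self (h : IsScalarProduct G) {x : E × (E →L[ℝ] ℝ)}
    (hx : linSasaki G x x = 0) : x = 0 := by
  rw [linSasaki_apply,
    add_eq_zero_iff_of_nonneg (h.nonneg x.1) (h.apply_symm_self_nonneg x.2)] at hx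
  exact Prod.ext (h.eq_zero hx.1) (h.eq_zero_of_apply_symm_self hx.2)

theorem exists_orthogonal_sub [FiniteDimensional ℝ E] (h : IsScalarProduct G)
    (V : Submodule ℝ E) (w : E) : ∃ τ ∈ V, ∀ v ∈ V, G (w - τ) v = 0 := by
  let B : LinearMap.BilinForm ℝ E := ContinuousLinearMap.coeLM ℝ ∘ₗ G.toLinearMap
  have hrefl : B.IsRefl := fun v w hvw => (h.symm w v).trans hvw
  have hcompl : IsCompl V (B.orthogonal V) := by
    refine (LinearMap.BilinForm.isCompl_orthogonal_iff_disjoint hrefl).2 ?_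
    exact Submodule.disjoint_def.2 fun v hv hvV => h.eq_zero (hvV v hv)
  obtain ⟨τ, hτ, ν, hν, rfl⟩ :=
    Submodule.mem_sup.1 (hcompl.sup_eq_top ▸ Submodule.mem_top : w ∈ V ⊔ B.orthogonal V)
  refine ⟨τ, hτ, fun v hv => ?_⟩
  rw [add_sub_cancel_left, h.symm]
  exact hν v hv

end IsScalarProduct

theorem contDiffOn_hessOp {ζ : ℝ → E × (E →L[ℝ] ℝ)} (hζ : ContDiffOn ℝ ∞ ζ (Icc 0 1)) :
    ContDiffOn ℝ ∞ (hessOp G ζ) (Icc 0 1) :=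
  (G.symm.contDiff.comp_contDiffOn (contDiffOn_dt hζ).snd).prodMk
    (hζ.snd.sub (G.contDiff.comp_contDiffOn (contDiffOn_dt hζ).fst))

theorem contDiffOn_linSasaki {ζ₁ ζ₂ : ℝ → E × (E →L[ℝ] ℝ)} (h₁ : ContDiffOn ℝ ∞ ζ₁ (Icc 0 1))
    (h₂ : ContDiffOn ℝ ∞ ζ₂ (Icc 0 1)) :
    ContDiffOn ℝ ∞ (fun t => linSasaki G (ζ₁ t) (ζ₂ t)) (Icc 0 1) := by
  simp only [linSasaki_apply]
  exact ((G.contDiff.comp_contDiffOn h₁.fst).clm_apply h₂.fst).add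
    (h₁.snd.clm_apply (G.symm.contDiff.comp_contDiffOn h₂.snd))

theorem hasDerivWithinAt_fst {ζ : ℝ → E × (E →L[ℝ] ℝ)} (hζ : ContDiffOn ℝ ∞ ζ (Icc 0 1)) (t : I) :
    HasDerivWithinAt (fun t => (ζ t).1) (dt ζ t).1 (Icc 0 1) t :=
  (ContinuousLinearMap.fst ℝ E (E →L[ℝ] ℝ)).hasFDerivAt.comp_hasDerivWithinAt _
    (hasDerivWithinAt_dt hζ t)

theorem hasDerivWithinAt_snd {ζ : ℝ → E × (E →L[ℝ] ℝ)} (hζ : ContDiffOn ℝ ∞ ζ (Icc 0 1)) (t : I) :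
    HasDerivWithinAt (fun t => (ζ t).2) (dt ζ t).2 (Icc 0 1) t :=
  (ContinuousLinearMap.snd ℝ E (E →L[ℝ] ℝ)).hasFDerivAt.comp_hasDerivWithinAt _
    (hasDerivWithinAt_dt hζ t)

theorem dt_snd_apply_fst {ζ₁ ζ₂ : ℝ → E × (E →L[ℝ] ℝ)} (h₁ : ContDiffOn ℝ ∞ ζ₁ (Icc 0 1))
    (h₂ : ContDiffOn ℝ ∞ ζ₂ (Icc 0 1)) (t : I) :
    dt (fun t => (ζ₁ t).2 (ζ₂ t).1) t = (dt ζ₁ t).2 (ζ₂ t).1 + (ζ₁ t).2 (dt ζ₂ t).1 :=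
  dt_eq_of_hasDerivWithinAt ((hasDerivWithinAt_snd h₁ t).clm_apply (hasDerivWithinAt_fst h₂ t))

/-- Integration by parts: the boundary terms vanish since the end points are conormal. -/
theorem linHess_eq_integral_hessOp (hG : IsScalarProduct G) {ζ₁ ζ₂ : ℝ → E × (E →L[ℝ] ℝ)}
    (h₁ : IsAdmissible (linConormal V) ζ₁) (h₂ : IsAdmissible (linConormal V) ζ₂) :
    linHess G ζ₁ ζ₂ = ∫ t : I, linSasaki G (hessOp G ζ₁ t) (ζ₂ t) := by
  have hpair : ContDiffOn ℝ ∞ (fun t => (ζ₁ t).2 (ζ₂ t).1) (Icc 0 1) :=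
    h₁.1.snd.clm_apply h₂.1.fst
  have hboundary : ∫ t : I, dt (fun t => (ζ₁ t).2 (ζ₂ t).1) t = 0 := by
    rw [integral_dt hpair, h₁.2.2.2 _ h₂.2.2.1, h₁.2.1.2 _ h₂.2.1.1, sub_zero]
  rw [linHess, ← sub_zero (∫ t : I, linSasaki G (hessOp G ζ₁ t) (ζ₂ t)), ← hboundary,
    ← integral_sub (integrable_of_contDiffOn (contDiffOn_linSasaki (contDiffOn_hessOp h₁.1) h₂.1))
      (integrable_of_contDiffOn (contDiffOn_dt hpair))]
  refine integral_congr_ae (ae_of_all _ fun t => ?_)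
  have hsharp : G (dt ζ₁ t).1 (G.symm (ζ₂ t).2) = (ζ₂ t).2 (dt ζ₁ t).1 := by
    rw [hG.apply_symm_comm, G.symm_apply_apply]
  simp only [dt_snd_apply_fst h₁.1 h₂.1, linSasaki_apply, hessOp, G.apply_symm_apply,
    sub_apply, hsharp]
  ring

theorem hessOp_eq_zero_of_forall_linHess_eq_zero (hG : IsScalarProduct G)
    {ζ : ℝ → E × (E →L[ℝ] ℝ)} (hζ : IsAdmissible (linConormal V) ζ)
    (hker : ∀ ζ₂, IsAdmissible (linConormal V) ζ₂ → linHess G ζ ζ₂ = 0) (t : I) :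
    hessOp G ζ t = 0 := by
  have hop : ContDiffOn ℝ ∞ (hessOp G ζ) (Icc 0 1) := contDiffOn_hessOp hζ.1
  have hadm : IsAdmissible (linConormal V) fun t => (t * (1 - t)) • hessOp G ζ t :=
    ⟨(by fun_prop : ContDiff ℝ ∞ fun t : ℝ => t * (1 - t)).contDiffOn.smul hop,
      by simp, by simp⟩
  refine hG.eq_zero_of_linSasaki_self
    (eq_zero_of_integral_mul_one_sub_mul_eq_zero
      (f := fun t => linSasaki G (hessOp G ζ t) (hessOp G ζ t)) (contDiffOn_linSasaki hop hop)
      (fun t => hG.linSasaki_self_nonneg _) ?_ t)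
  simpa [linHess_eq_integral_hessOp hG hζ hadm] using hker _ hadm

/-- `hessOp G ζ = 0` is the equation of geodesics in flat space; the velocity `b♯` of a solution
is both tangent and orthogonal to `V`. -/
theorem eq_const_of_hessOp_eq_zero (hG : IsScalarProduct G) {ζ : ℝ → E × (E →L[ℝ] ℝ)}
    (hζ : IsAdmissible (linConormal V) ζ) (hzero : ∀ t : I, hessOp G ζ t = 0) :
    (ζ 0).1 ∈ V ∧ ∀ t : I, ζ t = ((ζ 0).1, 0) := by
  have hmomentum (t : I) : (dt ζ t).2 = 0 := by
    simpa [hessOp] using congrArg Prod.fst (hzero t)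
  have hvelocity (t : I) : (dt ζ t).1 = G.symm (ζ t).2 :=
    (G.symm_apply_eq.2 (sub_eq_zero.1 (congrArg Prod.snd (hzero t)))).symm
  have hsnd : ∀ t : I, (ζ t).2 = (ζ 0).2 :=
    eq_of_dt_eq_zero hζ.1.snd fun t =>
      (dt_eq_of_hasDerivWithinAt (hasDerivWithinAt_snd hζ.1 t)).trans (hmomentum t)
  have hfst (t : I) : (ζ t).1 = (ζ 0).1 + (t : ℝ) • G.symm (ζ 0).2 := by
    have hline := eq_of_dt_eq_zero (f := fun t => (ζ t).1 - t • G.symm (ζ 0).2)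
      (hζ.1.fst.sub (by fun_prop)) (fun t => ?_) t
    · simpa [sub_eq_iff_eq_add] using hline
    · have hd := (hasDerivWithinAt_fst hζ.1 t).sub
        ((hasDerivAt_id (t : ℝ)).smul_const (G.symm (ζ 0).2)).hasDerivWithinAt
      refine (dt_eq_of_hasDerivWithinAt hd).trans ?_
      simp [hvelocity t, hsnd t]
  have hsharp_mem : G.symm (ζ 0).2 ∈ V := by
    have hone : (ζ 1).1 - (ζ 0).1 = G.symm (ζ 0).2 := by simpa [sub_eq_iff_eq_add'] using hfst 1
    exact hone ▸ V.sub_mem hζ.2.2.1 hζ.2.1.1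
  have hsharp : G.symm (ζ 0).2 = 0 :=
    hG.eq_zero (by simpa using hζ.2.1.2 _ hsharp_mem)
  have hsnd0 : (ζ 0).2 = 0 := by simpa using hsharp
  exact ⟨hζ.2.1.1, fun t => Prod.ext (by simpa [hsharp] using hfst t) ((hsnd t).trans hsnd0)⟩

/-- The solution is found by integrating twice; the end conditions are met by subtracting from
the first integral its tangential part `τ`, and by adding a constant `ν` orthogonal to `V`. -/
theorem exists_hessOp_eq_sub_const [FiniteDimensional ℝ E] (hG : IsScalarProduct G)
    (V : Submodule ℝ E) {f : ℝ → E} {h : ℝ → E →L[ℝ] ℝ} (hf : ContDiff ℝ ∞ f)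
    (hh : ContDiff ℝ ∞ h) :
    ∃ ζ, IsAdmissible (linConormal V) ζ ∧ ∃ τ ∈ V, ∀ t : I, hessOp G ζ t = (f t - τ, h t) := by
  have : CompleteSpace E := FiniteDimensional.complete ℝ E
  obtain ⟨F, hF, hFd, hF0⟩ := exists_primitive hf
  obtain ⟨Φ, hΦ, hΦd, hΦ0⟩ := exists_primitive hF
  obtain ⟨K, hK, hKd, hK0⟩ := exists_primitive hh
  obtain ⟨τ, hτ, hτV⟩ := hG.exists_orthogonal_sub V (F 1)
  obtain ⟨ρ, hρ, hρV⟩ := hG.exists_orthogonal_sub V (Φ 1 - G.symm (K 1))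
  set ν := ρ - (Φ 1 - G.symm (K 1)) with hν
  have hνV : ∀ v ∈ V, G ν v = 0 := fun v hv => by
    rw [hν, ← neg_sub, map_neg, neg_apply, hρV v hv, neg_zero]
  let ζ : ℝ → E × (E →L[ℝ] ℝ) := fun t =>
    (Φ t - (t ^ 2 / 2) • τ + t • ν - G.symm (K t), G (F t - t • τ + ν))
  have hderiv (t : ℝ) :
      HasDerivAt ζ (F t - t • τ + ν - G.symm (h t), G (f t - τ)) t := by
    have hsq : HasDerivAt (fun t : ℝ => t ^ 2 / 2) t t := by
      simpa using (hasDerivAt_pow 2 t).div_const 2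
    have hlin (x : E) : HasDerivAt (fun t : ℝ => t • x) x t := by
      simpa using (hasDerivAt_id t).smul_const x
    exact ((((hΦd t).sub (hsq.smul_const τ)).add (hlin ν)).sub
      (G.symm.hasFDerivAt.comp_hasDerivAt t (hKd t))).prodMk
      (G.hasFDerivAt.comp_hasDerivAt t (((hFd t).sub (hlin τ)).add_const ν))
  refine ⟨ζ, ⟨ContDiff.contDiffOn (by fun_prop), ⟨?_, fun v hv => ?_⟩, ⟨?_, fun v hv => ?_⟩⟩,
    τ, hτ, fun t => ?_⟩
  · simp [ζ, hΦ0, hK0]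
  · simp [ζ, hF0, hνV v hv]
  · have hone : (ζ 1).1 = ρ - (1 / 2 : ℝ) • τ := by
      simp only [ζ, hν, one_pow, one_smul]
      abel
    exact hone ▸ V.sub_mem hρ (V.smul_mem _ hτ)
  · have hone : (ζ 1).2 = G (F 1 - τ) + G ν := by simp [ζ]
    rw [hone, add_apply, hτV v hv, hνV v hv, add_zero]
  · have hd := dt_eq_of_hasDerivWithinAt (t := t) (hderiv t).hasDerivWithinAt
    rw [hessOp, hd]
    simp [ζ]

theorem integral_linSasaki_eq_zero_of_cokernel [FiniteDimensional ℝ E] (hG : IsScalarProduct G)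
    {η : I → E × (E →L[ℝ] ℝ)} (hη : Integrable η)
    (hcoker : ∀ ζ, IsAdmissible (linConormal V) ζ → ∫ t : I, linSasaki G (hessOp G ζ t) (η t) = 0)
    (hann : ∀ v ∈ V, ∫ t : I, linSasaki G (v, 0) (η t) = 0)
    {ψ : ℝ → ℝ} (hψ : ContDiff ℝ ∞ ψ) (x : E × (E →L[ℝ] ℝ)) :
    ∫ t : I, linSasaki G x (ψ t • η t) = 0 := by
  obtain ⟨ζ, hζ, τ, hτ, hop⟩ := exists_hessOp_eq_sub_const hG V
    (hψ.smul contDiff_const : ContDiff ℝ ∞ fun t => ψ t • x.1)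
    (hψ.smul contDiff_const : ContDiff ℝ ∞ fun t => ψ t • x.2)
  have hsplit (t : I) : linSasaki G (hessOp G ζ t) (η t) =
      linSasaki G x (ψ t • η t) - linSasaki G (τ, 0) (η t) := by
    simp only [hop t, linSasaki_apply]
    simp
    ring
  have hzero := hcoker ζ hζ
  simp only [hsplit] at hzero
  rwa [integral_sub
    ((linSasaki G x).integrable_comp (integrable_continuous_smul hη hψ.continuous))
    ((linSasaki G (τ, 0)).integrable_comp hη), hann τ hτ, sub_zero] at hzero

/-- The image of `hessOp` contains all smooth fields up to constant ones tangent to `V`. -/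
theorem ae_eq_zero_of_cokernel [FiniteDimensional ℝ E] (hG : IsScalarProduct G)
    {η : I → E × (E →L[ℝ] ℝ)} (hη : Integrable η)
    (hcoker : ∀ ζ, IsAdmissible (linConormal V) ζ → ∫ t : I, linSasaki G (hessOp G ζ t) (η t) = 0)
    (hann : ∀ v ∈ V, ∫ t : I, linSasaki G (v, 0) (η t) = 0) : η =ᵐ[volume] 0 := by
  have : CompleteSpace E := FiniteDimensional.complete ℝ E
  refine ae_eq_zero_of_forall_integral_smul_eq_zero hη fun ψ hψ => ?_
  refine hG.eq_zero_of_linSasaki_self ?_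
  rw [← ContinuousLinearMap.integral_comp_comm _ (integrable_continuous_smul hη hψ.continuous)]
  exact integral_linSasaki_eq_zero_of_cokernel hG hη hcoker hann hψ _

end LinearModel

/-! ### Canonical coordinates on the cotangent bundle -/

section Coordinates

variable {n : ℕ} {N : Type*} [TopologicalSpace N] [ChartedSpace (Model n) N]
  [IsManifold (𝓡 n) ∞ N]

/-- The canonical coordinates `(q, p)` of `T*N` induced by the preferred chart of `N` at `q`. -/
abbrev covChart (q : N) : PartialEquiv (Cotangent n N) (CotModel n) :=
  extChartAt (cotI n) (zeroCov (n := n) q)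

/-- The derivative at `y` of the preferred chart at `q`. -/
def chartD (q y : N) : Model n →L[ℝ] Model n :=
  (trivializationAt (Model n) (TangentSpace (𝓡 n)) q).continuousLinearMapAt ℝ y

/-- The inverse of the derivative at `y` of the preferred chart at `q`. -/
def chartDsymm (q y : N) : Model n →L[ℝ] Model n :=
  (trivializationAt (Model n) (TangentSpace (𝓡 n)) q).symmL ℝ y

/-- A covector as a linear form on the model space. -/
def covec (x : Cotangent n N) : Model n →L[ℝ] ℝ := x.2

theorem chartD_symm {q y : N} (hy : y ∈ (chartAt (Model n) q).source) (v : Model n) :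
    chartD q y (chartDsymm q y v) = v :=
  (trivializationAt (Model n) (TangentSpace (𝓡 n)) q).continuousLinearMapAt_symmL (R := ℝ)
    (by simpa using hy) v

theorem chartDsymm_chartD {q y : N} (hy : y ∈ (chartAt (Model n) q).source)
    (v : Model n) : chartDsymm q y (chartD q y v) = v :=
  (trivializationAt (Model n) (TangentSpace (𝓡 n)) q).symmL_continuousLinearMapAt (R := ℝ)
    (by simpa using hy) (show TangentSpace (𝓡 n) y from v)

theorem chartD_eq_mfderiv {q y : N} (hy : y ∈ (chartAt (Model n) q).source) :
    chartD q y = mfderiv (𝓡 n) 𝓘(ℝ, Model n) (extChartAt (𝓡 n) q) y :=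
  TangentBundle.continuousLinearMapAt_trivializationAt hy

theorem chartD_self (q : N) (v : Model n) : chartD q q v = v := by
  rw [chartD_eq_mfderiv (mem_chart_source _ q), mfderiv_extChartAt_self]
  rfl

theorem mem_covChart_source {q : N} {x : Cotangent n N} :
    x ∈ (covChart q).source ↔ x.1 ∈ (chartAt (Model n) q).source := by
  rw [covChart, FiberBundle.extChartAt]
  simp [zeroCov, hom_trivializationAt_apply]

theorem covChart_target (q : N) :
    (covChart q).target = (chartAt (Model n) q).target ×ˢ (univ : Set (Model n →L[ℝ] ℝ)) := by
  rw [covChart, FiberBundle.extChartAt_target]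
  ext x
  simpa [zeroCov] using fun h => (chartAt (Model n) q).map_target h

theorem covChart_fst (q : N) (x : Cotangent n N) :
    (covChart q x).1 = chartAt (Model n) q x.1 := by
  rw [covChart, FiberBundle.extChartAt]
  simp [zeroCov, hom_trivializationAt_apply]

theorem covChart_snd_apply (q : N) (x : Cotangent n N) (v : Model n) :
    (covChart q x).2 v = covec x (chartDsymm q x.1 v) := by
  rw [covChart, FiberBundle.extChartAt]
  simp [covec, chartDsymm, zeroCov, hom_trivializationAt_apply, ContinuousLinearMap.inCoordinates]
  rfl

theorem covChart_snd_chartD {q : N} {x : Cotangent n N}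
    (hx : x.1 ∈ (chartAt (Model n) q).source) (w : Model n) :
    (covChart q x).2 (chartD q x.1 w) = covec x w := by
  rw [covChart_snd_apply, chartDsymm_chartD hx]

theorem covChart_zeroCov (q y : N) : covChart q (zeroCov y) = (chartAt (Model n) q y, 0) := by
  refine Prod.ext (covChart_fst q _) ?_
  ext v
  rw [covChart_snd_apply]
  rfl

/-- The derivative at `y` of the preferred chart at `q`, as an isomorphism. -/
def chartDEquiv {q y : N} (hy : y ∈ (chartAt (Model n) q).source) : Model n ≃L[ℝ] Model n :=
  ContinuousLinearEquiv.equivOfInverse (chartD q y) (chartDsymm q y) (chartDsymm_chartD hy)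
    (chartD_symm hy)

theorem mdifferentiableAt_covChart {q : N} {x : Cotangent n N}
    (hx : x.1 ∈ (chartAt (Model n) q).source) :
    MDifferentiableAt (cotI n) 𝓘(ℝ, CotModel n) (covChart q) x :=
  mdifferentiableAt_extChartAt (by simpa [extChartAt_source] using mem_covChart_source.2 hx)

theorem mfderiv_covChart_fst {q : N} {x : Cotangent n N}
    (hx : x.1 ∈ (chartAt (Model n) q).source) (ζ : TangentSpace (cotI n) x) :
    (mfderiv (cotI n) 𝓘(ℝ, CotModel n) (covChart q) x ζ : CotModel n).1 =
      mfderiv (𝓡 n) 𝓘(ℝ, Model n) (extChartAt (𝓡 n) q) x.1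
        (mfderiv (cotI n) (𝓡 n) (fun y : Cotangent n N => y.1) x ζ) := by
  have hproj : MDifferentiableAt (cotI n) (𝓡 n) (fun y : Cotangent n N => y.1) x :=
    (contMDiff_proj (n := 1) _).mdifferentiable one_ne_zero x
  have hfst : MDifferentiableAt 𝓘(ℝ, CotModel n) 𝓘(ℝ, Model n) (Prod.fst : CotModel n → Model n)
      (covChart q x) := differentiableAt_fst.mdifferentiableAt
  have hcomm : (extChartAt (𝓡 n) q ∘ fun y : Cotangent n N => y.1) =
      (Prod.fst : CotModel n → Model n) ∘ covChart q :=
    funext fun y => (covChart_fst q y).symm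
  have hbase := mfderiv_comp x (mdifferentiableAt_extChartAt hx) hproj
  rw [hcomm, mfderiv_comp x hfst (mdifferentiableAt_covChart hx)] at hbase
  refine Eq.trans ?_ (congrArg (fun L => L ζ) hbase)
  rw [mfderiv_eq_fderiv, fderiv_fst]
  rfl

theorem liouville_eq {q : N} {x : Cotangent n N} (hx : x.1 ∈ (chartAt (Model n) q).source)
    (ζ : TangentSpace (cotI n) x) :
    liouville x ζ =
      (covChart q x).2 (mfderiv (cotI n) 𝓘(ℝ, CotModel n) (covChart q) x ζ : CotModel n).1 := by
  rw [mfderiv_covChart_fst hx, ← chartD_eq_mfderiv hx]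
  exact (covChart_snd_chartD hx _).symm

end Coordinates

/-! ### The kinetic energy in canonical coordinates -/

section Kinetic

variable {n : ℕ} {N : Type*} [TopologicalSpace N] [ChartedSpace (Model n) N]
  [IsManifold (𝓡 n) ∞ N] (g : RiemMetric n N)

theorem inner_bijective (q : N) : Function.Bijective (g.inner q) := by
  refine ⟨(injective_iff_map_eq_zero (g.inner q)).2 fun v hv => ?_, exists_sharp g q⟩
  by_contra hne
  have hpos := g.pos q v hne
  rw [hv] at hpos
  exact lt_irrefl _ hpos

/-- The musical isomorphism `v ↦ g(v, ·)` at `q`, on the model space. -/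
def metricEquiv (q : N) : Model n ≃L[ℝ] (Model n →L[ℝ] ℝ) :=
  let f : Model n →ₗ[ℝ] (Model n →L[ℝ] ℝ) := (g.inner q).toLinearMap
  (LinearEquiv.ofBijective f (inner_bijective g q)).toContinuousLinearEquiv

theorem isScalarProduct_metricEquiv (q : N) : IsScalarProduct (metricEquiv g q) where
  symm := g.symm q
  pos := g.pos q

theorem metricEquiv_symm_apply (q : N) (α : Model n →L[ℝ] ℝ) :
    (metricEquiv g q).symm α = sharp g q α :=
  (metricEquiv g q).symm_apply_eq.2 (inner_sharp g q α).symm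

theorem kinetic_eq (x : Cotangent n N) :
    kinetic g x = (1 / 2) * covec x ((metricEquiv g x.1).symm (covec x)) := by
  rw [kinetic, inner_sharp, metricEquiv_symm_apply]
  rfl

theorem contMDiffAt_chartDsymm {q y : N} (hy : y ∈ (chartAt (Model n) q).source) (v : Model n) :
    ContMDiffAt (𝓡 n) (𝓡 n).tangent ∞
      (fun y => (⟨y, chartDsymm q y v⟩ : TangentBundle (𝓡 n) N)) y := by
  have hframe : ContMDiffAt (𝓡 n) ((𝓡 n).prod 𝓘(ℝ, Model n →L[ℝ] Model n)) ∞ (fun m : N =>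
      TotalSpace.mk' (Model n →L[ℝ] Model n) (E := fun m : N =>
        Bundle.Trivial N (Model n) m →L[ℝ] TangentSpace (𝓡 n) m) m
        ((trivializationAt (Model n) (TangentSpace (𝓡 n)) q).symmL ℝ m)) y :=
    (trivializationAt (Model n) (TangentSpace (𝓡 n)) q).contMDiffAt_symmL (by simpa using hy)
  have hconst : ContMDiffAt (𝓡 n) ((𝓡 n).prod 𝓘(ℝ, Model n)) ∞ (fun m : N =>
      TotalSpace.mk' (Model n) (E := Bundle.Trivial N (Model n)) m v) y := by
    rw [contMDiffAt_totalSpace]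
    exact ⟨contMDiffAt_id, contMDiffAt_const⟩
  exact ContMDiffAt.clm_bundle_apply (F₁ := Model n) (F₂ := Model n)
    (E₁ := Bundle.Trivial N (Model n)) (E₂ := fun m : N => TangentSpace (𝓡 n) m)
    (b := fun m : N => m) (v := fun _ => v)
    (ϕ := fun m => (trivializationAt (Model n) (TangentSpace (𝓡 n)) q).symmL ℝ m) hframe hconst

theorem contMDiffOn_metricEquiv_chartDsymm (q : N) (v w : Model n) :
    ContMDiffOn (𝓡 n) 𝓘(ℝ, ℝ) ∞
      (fun y => metricEquiv g y (chartDsymm q y v) (chartDsymm q y w))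
      (chartAt (Model n) q).source := by
  intro y hy
  have h := ContMDiffAt.clm_bundle_apply₂ (F₁ := Model n) (F₂ := Model n) (F₃ := ℝ)
    (E₁ := fun m : N => TangentSpace (𝓡 n) m) (E₂ := fun m : N => TangentSpace (𝓡 n) m)
    (E₃ := Bundle.Trivial N ℝ) (b := fun y : N => y)
    (v := fun y => (chartDsymm q y v : TangentSpace (𝓡 n) y))
    (w := fun y => (chartDsymm q y w : TangentSpace (𝓡 n) y))
    (ψ := fun y => g.inner y) (g.contMDiff y) (contMDiffAt_chartDsymm hy v)
    (contMDiffAt_chartDsymm hy w)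
  rw [contMDiffAt_totalSpace] at h
  exact h.2.contMDiffWithinAt

/-- The metric `(g_ij)` in the preferred chart at `q`. -/
def localMetric (q : N) (z : Model n) : Model n →L[ℝ] Model n →L[ℝ] ℝ :=
  (ContinuousLinearMap.compL ℝ (Model n) (Model n) ℝ).flip
      (chartDsymm q ((chartAt (Model n) q).symm z)) ∘L
    (metricEquiv g ((chartAt (Model n) q).symm z) : Model n →L[ℝ] Model n →L[ℝ] ℝ) ∘L
    chartDsymm q ((chartAt (Model n) q).symm z)

theorem contDiffOn_localMetric (q : N) :
    ContDiffOn ℝ ∞ (localMetric g q) (chartAt (Model n) q).target := by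
  refine contDiffOn_clm_apply.2 fun v => contDiffOn_clm_apply.2 fun w => ?_
  rw [← contMDiffOn_iff_contDiffOn]
  exact (contMDiffOn_metricEquiv_chartDsymm g q v w).comp contMDiffOn_chart_symm
    fun z hz => (chartAt (Model n) q).map_target hz

/-- The isomorphism given by the metric at `y`, read in the preferred chart at `q`. -/
def localMetricEquiv {q y : N} (hy : y ∈ (chartAt (Model n) q).source) :
    Model n ≃L[ℝ] (Model n →L[ℝ] ℝ) :=
  (chartDEquiv hy).symm.trans
    ((metricEquiv g y).trans ((chartDEquiv hy).arrowCongr (ContinuousLinearEquiv.refl ℝ ℝ)))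

theorem coe_localMetricEquiv {q y : N} (hy : y ∈ (chartAt (Model n) q).source) :
    (localMetricEquiv g hy : Model n →L[ℝ] Model n →L[ℝ] ℝ) =
      localMetric g q (chartAt (Model n) q y) := by
  rw [localMetric, (chartAt (Model n) q).left_inv hy]
  rfl

/-- The dual metric `(g^ij)` in the preferred chart at `q`. -/
def localSharp (q : N) (z : Model n) : (Model n →L[ℝ] ℝ) →L[ℝ] Model n :=
  (localMetric g q z).inverse

theorem localSharp_apply {q y : N} (hy : y ∈ (chartAt (Model n) q).source)
    (α : Model n →L[ℝ] ℝ) :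
    localSharp g q (chartAt (Model n) q y) α =
      chartD q y ((metricEquiv g y).symm (α ∘L chartD q y)) := by
  rw [localSharp, ← coe_localMetricEquiv g hy, ContinuousLinearMap.inverse_equiv]
  rfl

theorem contDiffOn_localSharp (q : N) :
    ContDiffOn ℝ ∞ (localSharp g q) (chartAt (Model n) q).target := by
  intro z hz
  have hinv : (localMetric g q z).IsInvertible := by
    rw [← (chartAt (Model n) q).right_inv hz,
      ← coe_localMetricEquiv g ((chartAt (Model n) q).map_target hz)]
    exact ContinuousLinearMap.isInvertible_equiv
  exact hinv.contDiffAt_map_inverse.comp_contDiffWithinAt z (contDiffOn_localMetric g q z hz)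

theorem localSharp_self (q : N) (α : Model n →L[ℝ] ℝ) :
    localSharp g q (chartAt (Model n) q q) α = (metricEquiv g q).symm α := by
  have hα : (α ∘L chartD q q : Model n →L[ℝ] ℝ) = α :=
    ContinuousLinearMap.ext fun v => congrArg α (chartD_self q v)
  rw [localSharp_apply g (mem_chart_source _ q), hα, chartD_self]

/-- The kinetic energy `½ gⁱʲ pᵢ pⱼ` in the canonical coordinates at `q`. -/
def localKinetic (q : N) (z : CotModel n) : ℝ :=
  (1 / 2) * z.2 (localSharp g q z.1 z.2)

theorem kinetic_eq_localKinetic {q : N} {x : Cotangent n N}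
    (hx : x.1 ∈ (chartAt (Model n) q).source) :
    kinetic g x = localKinetic g q (covChart q x) := by
  have hα : ((covChart q x).2 ∘L chartD q x.1 : Model n →L[ℝ] ℝ) = covec x :=
    ContinuousLinearMap.ext fun v => covChart_snd_chartD hx v
  rw [localKinetic, kinetic_eq, covChart_fst, localSharp_apply g hx, hα, covChart_snd_chartD hx]

theorem contDiffOn_localKinetic (q : N) :
    ContDiffOn ℝ ∞ (localKinetic g q) (Prod.fst ⁻¹' (chartAt (Model n) q).target) :=
  contDiffOn_const.mul (contDiffOn_snd.clm_apply
    (((contDiffOn_localSharp g q).comp contDiffOn_fst fun _ hz => hz).clm_apply contDiffOn_snd))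

theorem contMDiff_kinetic : ContMDiff (cotI n) 𝓘(ℝ, ℝ) ∞ (kinetic g) := by
  intro x
  have hx : x ∈ (covChart x.1).source := mem_covChart_source.2 (mem_chart_source _ x.1)
  have hchart : ContMDiffAt (cotI n) 𝓘(ℝ, CotModel n) ∞ (covChart x.1) x :=
    contMDiffAt_extChartAt' (by simpa [extChartAt_source] using hx)
  have hlocal : ContDiffAt ℝ ∞ (localKinetic g x.1) (covChart x.1 x) := by
    refine (contDiffOn_localKinetic g x.1).contDiffAt
      (((chartAt (Model n) x.1).open_target.preimage continuous_fst).mem_nhds ?_)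
    rw [mem_preimage, covChart_fst]
    exact mem_chart_target _ _
  refine (hlocal.contMDiffAt.comp x hchart).congr_of_eventuallyEq ?_
  filter_upwards [extChartAt_source_mem_nhds' hx] with y hy
  exact kinetic_eq_localKinetic g (mem_covChart_source.1 hy)

end Kinetic

/-! ### Straightening a subset of a manifold -/

section Diffeo

variable {E F : Type*} [NormedAddCommGroup E] [NormedSpace ℝ E] [NormedAddCommGroup F]
  [NormedSpace ℝ F] {τ : OpenPartialHomeomorph E F}

/-- `τ` is a diffeomorphism between open subsets of normed spaces. -/
structure IsDiffeo (τ : OpenPartialHomeomorph E F) : Prop where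
  contDiffOn : ContDiffOn ℝ ∞ τ τ.source
  contDiffOn_symm : ContDiffOn ℝ ∞ τ.symm τ.target

namespace IsDiffeo

theorem symm (hτ : IsDiffeo τ) : IsDiffeo τ.symm :=
  ⟨hτ.contDiffOn_symm, hτ.contDiffOn⟩

theorem hasFDerivAt (hτ : IsDiffeo τ) {x : E} (hx : x ∈ τ.source) :
    HasFDerivAt τ (fderiv ℝ τ x) x :=
  ((hτ.contDiffOn.contDiffAt (τ.open_source.mem_nhds hx)).differentiableAt (by simp)).hasFDerivAt

theorem contDiffOn_fderiv (hτ : IsDiffeo τ) : ContDiffOn ℝ ∞ (fderiv ℝ τ) τ.source :=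
  hτ.contDiffOn.fderiv_of_isOpen τ.open_source (by simp)

theorem fderiv_symm_comp_fderiv (hτ : IsDiffeo τ) {x : E} (hx : x ∈ τ.source) :
    fderiv ℝ τ.symm (τ x) ∘L fderiv ℝ τ x = ContinuousLinearMap.id ℝ E := by
  have hcomp := (hτ.symm.hasFDerivAt (τ.map_source hx)).comp x (hτ.hasFDerivAt hx)
  refine (hcomp.congr_of_eventuallyEq ?_).unique (hasFDerivAt_id x)
  filter_upwards [τ.open_source.mem_nhds hx] with y hy
  exact (τ.left_inv hy).symm

theorem fderiv_comp_fderiv_symm (hτ : IsDiffeo τ) {x : E} (hx : x ∈ τ.source) :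
    fderiv ℝ τ x ∘L fderiv ℝ τ.symm (τ x) = ContinuousLinearMap.id ℝ F := by
  simpa [τ.left_inv hx] using hτ.symm.fderiv_symm_comp_fderiv (τ.map_source hx)

theorem fderiv_symm_apply_fderiv (hτ : IsDiffeo τ) {x : E} (hx : x ∈ τ.source) (v : E) :
    fderiv ℝ τ.symm (τ x) (fderiv ℝ τ x v) = v :=
  congrArg (fun L => L v) (hτ.fderiv_symm_comp_fderiv hx)

theorem fderiv_apply_fderiv_symm (hτ : IsDiffeo τ) {x : E} (hx : x ∈ τ.source) (w : F) :
    fderiv ℝ τ x (fderiv ℝ τ.symm (τ x) w) = w :=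
  congrArg (fun L => L w) (hτ.fderiv_comp_fderiv_symm hx)

theorem exists_normalization {τ : OpenPartialHomeomorph E E} (hτ : IsDiffeo τ) {x : E}
    (hx : x ∈ τ.source) :
    ∃ τ' : OpenPartialHomeomorph E E, τ'.source = τ.source ∧ IsDiffeo τ' ∧ τ' x = 0 ∧
      fderiv ℝ τ' x = ContinuousLinearMap.id ℝ E ∧ ∃ A : E ≃L[ℝ] E, ∀ y, τ y = A (τ' y) + τ x := by
  let A : E ≃L[ℝ] E := ContinuousLinearEquiv.equivOfInverse (fderiv ℝ τ x) (fderiv ℝ τ.symm (τ x))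
    (hτ.fderiv_symm_apply_fderiv hx) (hτ.fderiv_apply_fderiv_symm hx)
  let h : E ≃ₜ E := (Homeomorph.subRight (τ x)).trans A.symm.toHomeomorph
  have hh : ∀ w, h w = A.symm (w - τ x) := fun w => rfl
  have hsmooth : ContDiff ℝ ∞ h := A.symm.contDiff.comp (contDiff_id.sub contDiff_const)
  have hderiv : HasFDerivAt (fun y => A.symm (τ y - τ x))
      ((A.symm : E →L[ℝ] E) ∘L fderiv ℝ τ x) x :=
    A.symm.hasFDerivAt.comp _ ((hτ.hasFDerivAt hx).sub_const _)
  refine ⟨τ.transHomeomorph h, rfl, ⟨hsmooth.comp_contDiffOn hτ.contDiffOn,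
    hτ.contDiffOn_symm.comp (A.contDiff.add contDiff_const).contDiffOn fun w hw => hw⟩,
    by simp [hh], hderiv.fderiv.trans (ContinuousLinearMap.ext A.symm_apply_apply), A, fun y => ?_⟩
  change τ y = A (A.symm (τ y - τ x)) + τ x
  rw [A.apply_symm_apply, sub_add_cancel]

end IsDiffeo

theorem isDiffeo_transition {M : Type*} [TopologicalSpace M] [ChartedSpace E M]
    {φ χ : OpenPartialHomeomorph M E} (hφ : φ ∈ IsManifold.maximalAtlas 𝓘(ℝ, E) ∞ M)
    (hχ : χ ∈ IsManifold.maximalAtlas 𝓘(ℝ, E) ∞ M) :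
    IsDiffeo (χ.symm.trans φ) := by
  have hsmooth : ∀ {φ χ : OpenPartialHomeomorph M E}, φ ∈ IsManifold.maximalAtlas 𝓘(ℝ, E) ∞ M →
      χ ∈ IsManifold.maximalAtlas 𝓘(ℝ, E) ∞ M →
      ContDiffOn ℝ ∞ (χ.symm.trans φ) (χ.symm.trans φ).source := fun hφ hχ =>
    ((contMDiffOn_of_mem_maximalAtlas hφ).comp ((contMDiffOn_symm_of_mem_maximalAtlas hχ).mono
      fun x hx => hx.1) fun x hx => hx.2).contDiffOn
  exact ⟨hsmooth hφ hχ, hsmooth hχ hφ⟩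

end Diffeo

section Straightening

variable {F : Type*} [NormedAddCommGroup F] [NormedSpace ℝ F]
  {H : Type*} [TopologicalSpace H] {J : ModelWithCorners ℝ F H}
  {M : Type*} [TopologicalSpace M] [ChartedSpace H M]

/-- A change of the preferred chart at `x` which straightens `S` to the linear subspace `V`, maps
`x` to the origin and is tangent to the identity there. -/
structure SliceChart (J : ModelWithCorners ℝ F H) (S : Set M) (x : M) (V : Submodule ℝ F) where
  /-- The change of coordinates. -/
  chg : OpenPartialHomeomorph F F
  isDiffeo : IsDiffeo chg
  source_subset : chg.source ⊆ (extChartAt J x).target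
  mem_source : extChartAt J x x ∈ chg.source
  map_base : chg (extChartAt J x x) = 0
  fderiv_base : fderiv ℝ chg (extChartAt J x x) = ContinuousLinearMap.id ℝ F
  mem_iff : ∀ z ∈ chg.source, (extChartAt J x).symm z ∈ S ↔ chg z ∈ V

section Velocity

variable [IsManifold J ∞ M]

theorem hasDerivAt_extChartAt_comp {c : ℝ → M} {s : ℝ} (hc : MDifferentiableAt 𝓘(ℝ, ℝ) J c s)
    {x₀ : M} (hs : c s ∈ (chartAt H x₀).source) :
    HasDerivAt (extChartAt J x₀ ∘ c)
      (mfderiv J 𝓘(ℝ, F) (extChartAt J x₀) (c s) (mfderiv 𝓘(ℝ, ℝ) J c s (1 : ℝ)) : F) s := by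
  have : IsManifold J 1 M := .of_le (n := ∞) (by simp)
  let L : ℝ →L[ℝ] F :=
    (mfderiv J 𝓘(ℝ, F) (extChartAt J x₀) (c s)).comp (mfderiv 𝓘(ℝ, ℝ) J c s)
  have hcomp : HasFDerivAt (extChartAt J x₀ ∘ c) L s :=
    ((mdifferentiableAt_extChartAt hs).hasMFDerivAt.comp s hc.hasMFDerivAt).hasFDerivAt
  exact hcomp.hasDerivAt

theorem curveVelocity_eq_iff {c : ℝ → M} {s : ℝ} (hc : ContMDiffAt 𝓘(ℝ, ℝ) J ∞ c s) {x x₀ : M}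
    (hx : x ∈ (chartAt H x₀).source) (v : TangentSpace J x) :
    curveVelocity J c s = (⟨x, v⟩ : TangentBundle J M) ↔
      c s = x ∧ HasDerivAt (extChartAt J x₀ ∘ c)
        (mfderiv J 𝓘(ℝ, F) (extChartAt J x₀) x v : F) s := by
  have : IsManifold J 1 M := .of_le (n := ∞) (by simp)
  have hcs := hc.mdifferentiableAt (by simp)
  constructor
  · intro h
    obtain rfl : c s = x := congrArg TotalSpace.proj h
    rw [curveVelocity, TotalSpace.mk_inj] at h
    rw [← h]
    exact ⟨rfl, hasDerivAt_extChartAt_comp hcs hx⟩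
  · rintro ⟨rfl, h⟩
    rw [curveVelocity, TotalSpace.mk_inj]
    have hinv : (mfderiv J 𝓘(ℝ, F) (extChartAt J x₀) (c s)).IsInvertible :=
      isInvertible_mfderiv_extChartAt (by rwa [extChartAt_source])
    exact hinv.injective ((hasDerivAt_extChartAt_comp hcs hx).unique h)

theorem curveVelocity_eq_iff_self {c : ℝ → M} {s : ℝ} (hc : ContMDiffAt 𝓘(ℝ, ℝ) J ∞ c s) {x : M}
    (v : TangentSpace J x) :
    curveVelocity J c s = (⟨x, v⟩ : TangentBundle J M) ↔
      c s = x ∧ HasDerivAt (extChartAt J x ∘ c) (v : F) s := by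
  have : IsManifold J 1 M := .of_le (n := ∞) (by simp)
  rw [curveVelocity_eq_iff hc (mem_chart_source H x) v, mfderiv_extChartAt_self]
  rfl

end Velocity

theorem hasDerivAt_mem_submodule [FiniteDimensional ℝ F] {V : Submodule ℝ F} {f : ℝ → F} {f' : F}
    {s : ℝ} (hf : HasDerivAt f f' s) (hV : ∀ᶠ r in 𝓝 s, f r ∈ V) : f' ∈ V := by
  refine V.closed_of_finiteDimensional.mem_of_tendsto (hasDerivAt_iff_tendsto_slope.1 hf) ?_
  filter_upwards [hV.filter_mono nhdsWithin_le_nhds] with r hr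
  exact V.smul_mem _ (V.sub_mem hr hV.self_of_nhds)

namespace SliceChart

variable {S : Set M} {x : M} {V : Submodule ℝ F} (s : SliceChart J S x V)

/-- The parametrisation of a neighbourhood of `x` by the straightened coordinates. -/
def param (w : F) : M := (extChartAt J x).symm (s.chg.symm w)

theorem zero_mem_target : (0 : F) ∈ s.chg.target := by
  rw [← s.map_base]
  exact s.chg.map_source s.mem_source

theorem param_zero : s.param 0 = x := by
  rw [param, ← s.map_base, s.chg.left_inv s.mem_source, extChartAt_to_inv]

theorem extChartAt_param {w : F} (hw : w ∈ s.chg.target) :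
    extChartAt J x (s.param w) = s.chg.symm w :=
  (extChartAt J x).right_inv (s.source_subset (s.chg.map_target hw))

theorem param_chg {y : M} (hy : y ∈ (chartAt H x).source)
    (hys : extChartAt J x y ∈ s.chg.source) : s.param (s.chg (extChartAt J x y)) = y := by
  rw [param, s.chg.left_inv hys, (extChartAt J x).left_inv (by rwa [extChartAt_source])]

theorem param_mem_iff {w : F} (hw : w ∈ s.chg.target) : s.param w ∈ S ↔ w ∈ V := by
  rw [param, s.mem_iff _ (s.chg.map_target hw), s.chg.right_inv hw]

variable [IsManifold J ∞ M]

theorem contMDiffOn_param : ContMDiffOn 𝓘(ℝ, F) J ∞ s.param s.chg.target :=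
  (contMDiffOn_extChartAt_symm _).comp s.isDiffeo.contDiffOn_symm.contMDiffOn
    fun _ hw => s.source_subset (s.chg.map_target hw)

theorem curveVelocity_param {y : M} (hy : y ∈ (chartAt H x).source)
    (hys : extChartAt J x y ∈ s.chg.source) (v : TangentSpace J y) :
    curveVelocity J (fun r : ℝ => s.param (s.chg (extChartAt J x y) + r •
      fderiv ℝ s.chg (extChartAt J x y) (mfderiv J 𝓘(ℝ, F) (extChartAt J x) y v))) 0 =
      (⟨y, v⟩ : TangentBundle J M) := by
  set w := s.chg (extChartAt J x y)
  set u : F := mfderiv J 𝓘(ℝ, F) (extChartAt J x) y v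
  set u' := fderiv ℝ s.chg (extChartAt J x y) u
  have hline : HasDerivAt (fun r : ℝ => w + r • u') u' 0 := by
    simpa using ((hasDerivAt_id (0 : ℝ)).smul_const u').const_add w
  have hw0 : w + (0 : ℝ) • u' ∈ s.chg.target := by
    simpa only [zero_smul, add_zero] using s.chg.map_source hys
  have hsmooth : ContMDiffAt 𝓘(ℝ, ℝ) J ∞ (fun r : ℝ => s.param (w + r • u')) 0 :=
    ContMDiffAt.comp (g := s.param) (0 : ℝ)
      (s.contMDiffOn_param.contMDiffAt (s.chg.open_target.mem_nhds hw0))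
      (ContDiff.contDiffAt (by fun_prop)).contMDiffAt
  refine (curveVelocity_eq_iff hsmooth hy v).2 ⟨?_, ?_⟩
  · rw [zero_smul, add_zero, s.param_chg hy hys]
  have hd := (s.isDiffeo.symm.hasFDerivAt hw0).comp_hasDerivAt (0 : ℝ) hline
  rw [zero_smul, add_zero, s.isDiffeo.fderiv_symm_apply_fderiv hys] at hd
  refine hd.congr_of_eventuallyEq ?_
  filter_upwards [hline.continuousAt.eventually_mem (s.chg.open_target.mem_nhds hw0)] with r hr
  exact s.extChartAt_param hr

theorem curveVelocity_param_smul (v : F) :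
    curveVelocity J (fun r : ℝ => s.param (r • v)) 0 = (⟨x, v⟩ : TangentBundle J M) := by
  have : IsManifold J 1 M := .of_le (n := ∞) (by simp)
  have h := s.curveVelocity_param (mem_chart_source H x) s.mem_source v
  simp only [s.map_base, zero_add, s.fderiv_base, mfderiv_extChartAt_self] at h
  exact h

theorem isTangentTo_iff [FiniteDimensional ℝ F] {y : M} (hy : y ∈ (chartAt H x).source)
    (hys : extChartAt J x y ∈ s.chg.source) (hyS : y ∈ S) (v : TangentSpace J y) :
    IsTangentTo J S y v ↔
      fderiv ℝ s.chg (extChartAt J x y) (mfderiv J 𝓘(ℝ, F) (extChartAt J x) y v) ∈ V := by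
  constructor
  · rintro ⟨c, U, hU, h0, hc, hcS, hv⟩
    have hc0 := hc.contMDiffAt (hU.mem_nhds h0)
    obtain ⟨rfl, hcd⟩ := (curveVelocity_eq_iff hc0 hy v).1 hv
    refine hasDerivAt_mem_submodule ((s.isDiffeo.hasFDerivAt hys).comp_hasDerivAt (0 : ℝ) hcd) ?_
    filter_upwards [hU.mem_nhds h0,
      hc0.continuousAt.eventually_mem ((chartAt H x).open_source.mem_nhds hy),
      hcd.continuousAt.eventually_mem (s.chg.open_source.mem_nhds hys)] with r hrU hr hrs
    have hparam : s.param (s.chg (extChartAt J x (c r))) = c r := s.param_chg hr hrs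
    exact (s.param_mem_iff (s.chg.map_source hrs)).1 (hparam.symm ▸ hcS r hrU)
  · intro hv
    set w := s.chg (extChartAt J x y)
    set u : F := fderiv ℝ s.chg (extChartAt J x y) (mfderiv J 𝓘(ℝ, F) (extChartAt J x) y v)
    have hw : w ∈ V := by
      rwa [← s.param_mem_iff (s.chg.map_source hys), s.param_chg hy hys]
    have hline : Continuous fun r : ℝ => w + r • u := by fun_prop
    refine ⟨fun r => s.param (w + r • u), (fun r : ℝ => w + r • u) ⁻¹' s.chg.target,
      s.chg.open_target.preimage hline, ?_, ?_, fun r hr => ?_, s.curveVelocity_param hy hys v⟩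
    · simpa only [mem_preimage, zero_smul, add_zero] using s.chg.map_source hys
    · exact s.contMDiffOn_param.comp (ContDiff.contDiffOn (by fun_prop)).contMDiffOn fun _ hr => hr
    · exact (s.param_mem_iff hr).2 (V.add_mem hw (V.smul_mem r hv))

theorem isTangentTo_base_iff [FiniteDimensional ℝ F] (s : SliceChart J S x V)
    (v : TangentSpace J x) : IsTangentTo J S x v ↔ (v : F) ∈ V := by
  have : IsManifold J 1 M := .of_le (n := ∞) (by simp)
  have hx : x ∈ S := by
    simpa [s.param_zero] using (s.param_mem_iff s.zero_mem_target).2 V.zero_mem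
  rw [s.isTangentTo_iff (mem_chart_source H x) s.mem_source hx, s.fderiv_base,
    mfderiv_extChartAt_self]
  rfl

end SliceChart

end Straightening

theorem exists_sliceChart_of_mem_maximalAtlas {E : Type*} [NormedAddCommGroup E] [NormedSpace ℝ E]
    {M : Type*} [TopologicalSpace M] [ChartedSpace E M] [IsManifold 𝓘(ℝ, E) ∞ M] {S : Set M} {x : M}
    (hx : x ∈ S) {φ : OpenPartialHomeomorph M E} (hφ : φ ∈ IsManifold.maximalAtlas 𝓘(ℝ, E) ∞ M)
    (hxφ : x ∈ φ.source) {W : Submodule ℝ E} (hW : ∀ y ∈ φ.source, y ∈ S ↔ φ y ∈ W) :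
    ∃ V : Submodule ℝ E, Nonempty (SliceChart 𝓘(ℝ, E) S x V) := by
  set χ := chartAt E x
  set τ := χ.symm.trans φ
  have hxχ : x ∈ χ.source := mem_chart_source E x
  have hbase : χ x ∈ τ.source := ⟨χ.map_source hxχ, by simpa [χ.left_inv hxχ] using hxφ⟩
  have hτS : ∀ z ∈ τ.source, χ.symm z ∈ S ↔ τ z ∈ W := fun z hz => hW _ hz.2
  have hτx : τ (χ x) ∈ W := by
    rwa [← hτS _ hbase, χ.left_inv hxχ]
  obtain ⟨τ', hsource, hdiffeo, hzero, hderiv, A, hA⟩ :=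
    (isDiffeo_transition hφ (IsManifold.chart_mem_maximalAtlas x)).exists_normalization hbase
  refine ⟨W.comap (A : E →L[ℝ] E).toLinearMap,
    ⟨⟨τ', hdiffeo, fun z hz => ?_, ?_, hzero, hderiv, fun z hz => ?_⟩⟩⟩
  · rw [hsource] at hz
    simpa using hz.1
  · rw [hsource]
    exact hbase
  · rw [hsource] at hz
    change χ.symm z ∈ S ↔ A (τ' z) ∈ W
    rw [hτS z hz, hA z, W.add_mem_iff_left hτx]

/-! ### Straightening the conormal bundle -/

section CotangentLift

variable {E F : Type*} [NormedAddCommGroup E] [NormedSpace ℝ E] [NormedAddCommGroup F]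
  [NormedSpace ℝ F]

/-- The transformation `(x, α) ↦ (τ x, (τ⁻¹)^* α)` of covectors induced by `τ`. -/
def cotangentMap (τ : OpenPartialHomeomorph E F) (z : E × (E →L[ℝ] ℝ)) : F × (F →L[ℝ] ℝ) :=
  (τ z.1, z.2 ∘L fderiv ℝ τ.symm (τ z.1))

namespace IsDiffeo

variable {τ : OpenPartialHomeomorph E F}

theorem contDiffOn_cotangentMap (hτ : IsDiffeo τ) :
    ContDiffOn ℝ ∞ (cotangentMap τ) (τ.source ×ˢ univ) := by
  have hfst : ContDiffOn ℝ ∞ (fun z : E × (E →L[ℝ] ℝ) => τ z.1) (τ.source ×ˢ univ) :=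
    hτ.contDiffOn.comp contDiffOn_fst fun z hz => hz.1
  exact hfst.prodMk (contDiffOn_snd.clm_comp
    (hτ.symm.contDiffOn_fderiv.comp hfst fun z hz => τ.map_source hz.1))

theorem cotangentMap_symm_cotangentMap (hτ : IsDiffeo τ) {z : E × (E →L[ℝ] ℝ)}
    (hz : z.1 ∈ τ.source) : cotangentMap τ.symm (cotangentMap τ z) = z := by
  refine Prod.ext (τ.left_inv hz) ?_
  change (z.2 ∘L fderiv ℝ τ.symm (τ z.1)) ∘L fderiv ℝ τ (τ.symm (τ z.1)) = z.2
  rw [τ.left_inv hz, ContinuousLinearMap.comp_assoc, hτ.fderiv_symm_comp_fderiv hz,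
    ContinuousLinearMap.comp_id]

/-- The canonical transformation of the cotangent spaces induced by a diffeomorphism `τ`. -/
def cotangentLift (hτ : IsDiffeo τ) :
    OpenPartialHomeomorph (E × (E →L[ℝ] ℝ)) (F × (F →L[ℝ] ℝ)) where
  toFun := cotangentMap τ
  invFun := cotangentMap τ.symm
  source := τ.source ×ˢ univ
  target := τ.target ×ˢ univ
  map_source' _ hz := ⟨τ.map_source hz.1, mem_univ _⟩
  map_target' _ hw := ⟨τ.map_target hw.1, mem_univ _⟩
  left_inv' _ hz := hτ.cotangentMap_symm_cotangentMap hz.1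
  right_inv' _ hw := hτ.symm.cotangentMap_symm_cotangentMap hw.1
  open_source := τ.open_source.prod isOpen_univ
  open_target := τ.open_target.prod isOpen_univ
  continuousOn_toFun := hτ.contDiffOn_cotangentMap.continuousOn
  continuousOn_invFun := hτ.symm.contDiffOn_cotangentMap.continuousOn

theorem isDiffeo_cotangentLift (hτ : IsDiffeo τ) : IsDiffeo hτ.cotangentLift :=
  ⟨hτ.contDiffOn_cotangentMap, hτ.symm.contDiffOn_cotangentMap⟩

theorem hasFDerivAt_cotangentMap_zero (hτ : IsDiffeo τ) {x : E} (hx : x ∈ τ.source) :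
    HasFDerivAt (cotangentMap τ) ((fderiv ℝ τ x).prodMap
      ((ContinuousLinearMap.compL ℝ F E ℝ).flip (fderiv ℝ τ.symm (τ x)))) (x, 0) := by
  have hfst : HasFDerivAt (fun z : E × (E →L[ℝ] ℝ) => τ z.1)
      (fderiv ℝ τ x ∘L ContinuousLinearMap.fst ℝ E (E →L[ℝ] ℝ)) (x, 0) :=
    HasFDerivAt.comp (x, 0) (hτ.hasFDerivAt hx) hasFDerivAt_fst
  have hsymm : DifferentiableAt ℝ (fderiv ℝ τ.symm) (τ x) :=
    (hτ.symm.contDiffOn_fderiv.contDiffAt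
      (τ.open_target.mem_nhds (τ.map_source hx))).differentiableAt (by simp)
  have hsnd := (hasFDerivAt_snd (𝕜 := ℝ) (p := (x, (0 : E →L[ℝ] ℝ)))).clm_comp
    (HasFDerivAt.comp (x, (0 : E →L[ℝ] ℝ)) hsymm.hasFDerivAt hfst)
  refine (hfst.prodMk hsnd).congr_fderiv (ContinuousLinearMap.ext fun z => ?_)
  refine Prod.ext rfl (ContinuousLinearMap.ext fun v => ?_)
  change (0 : E →L[ℝ] ℝ) (fderiv ℝ (fderiv ℝ τ.symm) (τ x) (fderiv ℝ τ x z.1) v) +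
    z.2 (fderiv ℝ τ.symm (τ x) v) = z.2 (fderiv ℝ τ.symm (τ x) v)
  rw [zero_apply, zero_add]

end IsDiffeo

end CotangentLift

section Conormal

variable {n : ℕ} {N : Type*} [TopologicalSpace N] [ChartedSpace (Model n) N]
  [IsManifold (𝓡 n) ∞ N] {T : Set N} {q : N} {V : Submodule ℝ (Model n)}

namespace SliceChart

variable (s : SliceChart (𝓡 n) T q V)

theorem mem_conormal_iff {x : Cotangent n N} (hx : x.1 ∈ (chartAt (Model n) q).source)
    (hxs : (covChart q x).1 ∈ s.chg.source) :
    x ∈ conormal T ↔ s.chg (covChart q x).1 ∈ V ∧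
      ∀ v, fderiv ℝ s.chg (covChart q x).1 v ∈ V → (covChart q x).2 v = 0 := by
  rw [covChart_fst] at hxs ⊢
  have hT : x.1 ∈ T ↔ s.chg (chartAt (Model n) q x.1) ∈ V := by
    rw [← s.param_mem_iff (s.chg.map_source hxs)]
    exact iff_of_eq (congrArg (· ∈ T) (s.param_chg hx hxs).symm)
  rw [← hT]
  refine and_congr_right fun hxT => ⟨fun h v hv => ?_, fun h v hv => ?_⟩
  · rw [covChart_snd_apply]
    refine h _ ((s.isTangentTo_iff hx hxs hxT _).2 ?_)
    rw [← chartD_eq_mfderiv hx]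
    exact (chartD_symm hx v).symm ▸ hv
  · have htangent := (s.isTangentTo_iff hx hxs hxT v).1 hv
    rw [← chartD_eq_mfderiv hx] at htangent
    exact (covChart_snd_chartD hx v).symm.trans (h _ htangent)

theorem covChart_symm_mem_conormal_iff {z : CotModel n} (hz : z.1 ∈ s.chg.source) :
    (covChart q).symm z ∈ conormal T ↔ cotangentMap s.chg z ∈ linConormal V := by
  have hzt : z ∈ (covChart q).target := by
    rw [covChart_target]
    exact ⟨by simpa using s.source_subset hz, mem_univ _⟩
  have hinv := (covChart q).right_inv hzt
  rw [s.mem_conormal_iff (mem_covChart_source.1 ((covChart q).map_target hzt)) (hinv.symm ▸ hz),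
    hinv]
  refine and_congr_right fun _ => ⟨fun h w hw => h _ ?_, fun h v hv => ?_⟩
  · exact (s.isDiffeo.fderiv_apply_fderiv_symm hz w).symm ▸ hw
  · rw [← s.isDiffeo.fderiv_symm_apply_fderiv hz v]
    exact h _ hv

/-- The slice chart of the conormal bundle at a point of the zero section induced by a slice chart
of `T`. -/
def conormalChart : SliceChart (cotI n) (conormal T) (zeroCov (n := n) q) (linConormal V) where
  chg := s.isDiffeo.cotangentLift
  isDiffeo := s.isDiffeo.isDiffeo_cotangentLift
  source_subset z hz := by
    rw [covChart_target]
    exact ⟨by simpa using s.source_subset hz.1, mem_univ _⟩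
  mem_source := by
    rw [covChart_zeroCov]
    exact ⟨s.mem_source, mem_univ _⟩
  map_base := by
    rw [covChart_zeroCov]
    exact Prod.ext s.map_base (ContinuousLinearMap.zero_comp _)
  fderiv_base := by
    have hsymm := s.isDiffeo.fderiv_symm_comp_fderiv s.mem_source
    rw [s.fderiv_base, ContinuousLinearMap.comp_id] at hsymm
    have hderiv := s.isDiffeo.hasFDerivAt_cotangentMap_zero s.mem_source
    rw [hsymm, s.fderiv_base] at hderiv
    rw [covChart_zeroCov]
    exact hderiv.fderiv
  mem_iff _ hz := s.covChart_symm_mem_conormal_iff hz.1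

end SliceChart

end Conormal

/-! ### Vector fields along a constant path -/

section ConstantPath

variable {F : Type*} [NormedAddCommGroup F] [NormedSpace ℝ F]
  {H : Type*} [TopologicalSpace H] {J : ModelWithCorners ℝ F H}
  {M : Type*} [TopologicalSpace M] [ChartedSpace H M] {S : Set M} {x : M} {V : Submodule ℝ F}

/-- A vector field along the constant path at `x`, extended to the line and read in the model
space. -/
def fieldExt (ξ : I → TangentSpace J x) : ℝ → F :=
  IccExtend (zero_le_one (α := ℝ)) ξ

theorem fieldExt_coe (ξ : I → TangentSpace J x) (t : I) : fieldExt ξ t = ξ t :=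
  IccExtend_val _ _ t

variable [IsManifold J ∞ M]

theorem trivializationAt_tangent_self (v : TangentSpace J x) :
    (trivializationAt F (TangentSpace J) x (⟨x, v⟩ : TangentBundle J M)).2 = v := by
  have : IsManifold J 1 M := .of_le (n := ∞) (by simp)
  rw [TangentBundle.trivializationAt_apply]
  exact tangentCoordChange_self (mem_extChartAt_source x)

theorem smoothPath_along_const_iff (ξ : I → TangentSpace J x) :
    SmoothPath J.tangent (fun t => (⟨x, ξ t⟩ : TangentBundle J M)) ↔
      ContDiffOn ℝ ∞ (fieldExt ξ) (Icc (0 : ℝ) 1) := by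
  rw [← contMDiffOn_iff_contDiffOn]
  refine forall₂_congr fun t ht => ?_
  rw [contMDiffWithinAt_totalSpace]
  have hbase : ContMDiffWithinAt 𝓘(ℝ, ℝ) J ∞ (fun t : ℝ => (IccExtend (zero_le_one (α := ℝ))
      (fun t => (⟨x, ξ t⟩ : TangentBundle J M)) t).proj) (Icc 0 1) t := contMDiffWithinAt_const
  have hfibre : (fun r : ℝ => (trivializationAt F (TangentSpace J)
      (IccExtend (zero_le_one (α := ℝ)) (fun t => (⟨x, ξ t⟩ : TangentBundle J M)) t).proj
      (IccExtend (zero_le_one (α := ℝ)) (fun t => (⟨x, ξ t⟩ : TangentBundle J M)) r)).2) =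
      fieldExt ξ :=
    funext fun r => trivializationAt_tangent_self _
  rw [hfibre]
  exact and_iff_right hbase

namespace SliceChart

variable [FiniteDimensional ℝ F]

theorem mem_pathTangent_iff (s : SliceChart J S x V) (ξ : I → TangentSpace J x) :
    ξ ∈ pathTangent J S (fun _ => x) ↔ IsAdmissible V (fieldExt ξ) := by
  refine and_congr (smoothPath_along_const_iff ξ) (and_congr ?_ ?_)
  · rw [show fieldExt ξ 0 = ξ 0 from fieldExt_coe ξ 0]
    exact s.isTangentTo_base_iff _
  · rw [show fieldExt ξ 1 = ξ 1 from fieldExt_coe ξ 1]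
    exact s.isTangentTo_base_iff _

theorem exists_isVariation (s : SliceChart J S x V) {ξ₁ ξ₂ : I → TangentSpace J x}
    (h₁ : ξ₁ ∈ pathTangent J S (fun _ => x)) (h₂ : ξ₂ ∈ pathTangent J S (fun _ => x)) :
    ∃ Γ, IsVariation J S (fun _ => x) ξ₁ ξ₂ Γ := by
  rw [s.mem_pathTangent_iff] at h₁ h₂
  let L : (ℝ × ℝ) × ℝ → F := fun z => z.1.1 • fieldExt ξ₁ z.2 + z.1.2 • fieldExt ξ₂ z.2
  have hL : ContDiffOn ℝ ∞ L (univ ×ˢ Icc (0 : ℝ) 1) := by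
    have hmaps : MapsTo (Prod.snd : (ℝ × ℝ) × ℝ → ℝ) (univ ×ˢ Icc (0 : ℝ) 1) (Icc 0 1) :=
      fun z hz => hz.2
    exact (contDiff_fst.fst.contDiffOn.smul (h₁.1.comp contDiffOn_snd hmaps)).add
      (contDiff_fst.snd.contDiffOn.smul (h₂.1.comp contDiffOn_snd hmaps))
  obtain ⟨U, hU, h0, -, hUL⟩ := exists_isOpen_mapsTo_prod isCompact_Icc isOpen_univ
    (mem_univ (0 : ℝ × ℝ)) hL.continuousOn s.chg.open_target fun t _ => by
      simpa [L] using s.zero_mem_target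
  have hend : ∀ z ∈ U, ∀ t : I, fieldExt ξ₁ t ∈ V → fieldExt ξ₂ t ∈ V →
      s.param (L (z, t)) ∈ S := fun z hz t e₁ e₂ =>
    (s.param_mem_iff (hUL (mk_mem_prod hz t.2))).2
      (V.add_mem (V.smul_mem _ e₁) (V.smul_mem _ e₂))
  refine ⟨fun z t => s.param (L (z, t)), ⟨U, hU, h0, ?_, fun z hz =>
    ⟨hend z hz 0 h₁.2.1 h₂.2.1, hend z hz 1 h₁.2.2 h₂.2.2⟩⟩, fun t => ?_, fun t => ?_⟩
  · refine (s.contMDiffOn_param.comp (hL.mono (prod_mono_left (subset_univ _))).contMDiffOn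
      hUL).congr fun z hz => ?_
    rw [IccExtend_of_mem _ _ hz.2]
    rfl
  · refine Eq.trans (congrArg (fun c => curveVelocity J c 0) (funext fun r => congrArg s.param ?_))
      (s.curveVelocity_param_smul (ξ₁ t))
    rw [← fieldExt_coe ξ₁ t]
    change r • fieldExt ξ₁ t + (0 : ℝ) • fieldExt ξ₂ t = r • fieldExt ξ₁ t
    rw [zero_smul, add_zero]
  · refine Eq.trans (congrArg (fun c => curveVelocity J c 0) (funext fun r => congrArg s.param ?_))
      (s.curveVelocity_param_smul (ξ₂ t))
    rw [← fieldExt_coe ξ₂ t]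
    change (0 : ℝ) • fieldExt ξ₁ t + r • fieldExt ξ₂ t = r • fieldExt ξ₂ t
    rw [zero_smul, zero_add]

end SliceChart

end ConstantPath

theorem IsSubmanifold.exists_sliceChart {n k : ℕ} {N : Type*} [TopologicalSpace N]
    [ChartedSpace (Model n) N] [IsManifold (𝓡 n) ∞ N] {T : Set N} (hT : IsSubmanifold n k T) {q : N}
    (hq : q ∈ T) : ∃ V : Submodule ℝ (Model n), Nonempty (SliceChart (𝓡 n) T q V) := by
  obtain ⟨φ, hφ, hqφ, hslice⟩ := hT q hq
  let W : Submodule ℝ (Model n) :=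
    ⨅ i : {i : Fin n // k ≤ (i : ℕ)}, (EuclideanSpace.proj (𝕜 := ℝ) i.1).ker
  refine exists_sliceChart_of_mem_maximalAtlas hq hφ hqφ (W := W) fun y hy => ?_
  simp [W, hslice y hy]

/-! ### The second variation of the action -/

section Calculus

variable {P W E : Type*} [NormedAddCommGroup P] [NormedSpace ℝ P] [NormedAddCommGroup W]
  [NormedSpace ℝ W] [NormedAddCommGroup E] [NormedSpace ℝ E] {U : Set P}

theorem cylDeriv_fst (hU : IsOpen U) {F : P × ℝ → E × W} (hF : ContDiffOn ℝ ∞ F (U ×ˢ Icc 0 1))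
    (v : P × ℝ) {p : P × ℝ} (hp : p ∈ U ×ˢ Icc (0 : ℝ) 1) :
    cylDeriv U v (fun p => (F p).1) p = (cylDeriv U v F p).1 :=
  cylDeriv_eq_of_hasFDerivWithinAt hU hp
    (hF.differentiableOn (by simp) p hp).hasFDerivWithinAt.fst v

theorem cylDeriv_snd (hU : IsOpen U) {F : P × ℝ → E × W} (hF : ContDiffOn ℝ ∞ F (U ×ˢ Icc 0 1))
    (v : P × ℝ) {p : P × ℝ} (hp : p ∈ U ×ˢ Icc (0 : ℝ) 1) :
    cylDeriv U v (fun p => (F p).2) p = (cylDeriv U v F p).2 :=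
  cylDeriv_eq_of_hasFDerivWithinAt hU hp
    (hF.differentiableOn (by simp) p hp).hasFDerivWithinAt.snd v

theorem dt_slice {F : P × ℝ → W} (hF : ContDiffOn ℝ ∞ F (U ×ˢ Icc 0 1)) {z : P}
    (hz : z ∈ U) (t : I) : dt (fun r => F (z, r)) t = cylDeriv U (0, 1) F (z, t) := by
  have hslice : HasDerivWithinAt (fun r : ℝ => (z, r)) ((0 : P), (1 : ℝ)) (Icc (0 : ℝ) 1) t :=
    ((hasDerivAt_const (t : ℝ) z).prodMk (hasDerivAt_id (t : ℝ))).hasDerivWithinAt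
  have hFt := (hF.differentiableOn (by simp) (z, (t : ℝ)) ⟨hz, t.2⟩).hasFDerivWithinAt
  exact dt_eq_of_hasDerivWithinAt
    (hFt.comp_hasDerivWithinAt (t : ℝ) hslice fun r hr => ⟨hz, hr⟩)

theorem dt_congr {f f₁ : ℝ → W} (h : ∀ t : I, f t = f₁ t) (t : I) : dt f t = dt f₁ t :=
  derivWithin_congr (fun r hr => h ⟨r, hr⟩) (h t)

theorem cylDeriv_time_eq_zero {F : P × ℝ → W} (hF : ContDiffOn ℝ ∞ F (U ×ˢ Icc 0 1)) {z : P}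
    (hz : z ∈ U) {w : W} (hw : ∀ t : I, F (z, t) = w) (t : I) : cylDeriv U (0, 1) F (z, t) = 0 := by
  rw [← dt_slice hF hz, dt_congr (f₁ := fun _ => w) hw, dt, derivWithin_fun_const]
  rfl

theorem cylDeriv_cylDeriv_time (hU : IsOpen U) {F : P × ℝ → W}
    (hF : ContDiffOn ℝ ∞ F (U ×ˢ Icc 0 1)) {z : P} (hz : z ∈ U) {v : P × ℝ} {a : ℝ → W}
    (ha : ∀ t : I, cylDeriv U v F (z, t) = a t) (t : I) :
    cylDeriv U v (cylDeriv U (0, 1) F) (z, t) = dt a t := by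
  rw [cylDeriv_comm hU hF ⟨hz, t.2⟩, ← dt_slice (contDiffOn_cylDeriv hU hF v) hz, dt_congr ha]

end Calculus

section CanonicalCoordinates

variable {E : Type*} [NormedAddCommGroup E] [NormedSpace ℝ E] {U : Set (ℝ × ℝ)}
  {Z : (ℝ × ℝ) × ℝ → E × (E →L[ℝ] ℝ)} {x₀ : E} {ζ₁ ζ₂ : ℝ → E × (E →L[ℝ] ℝ)}

theorem hasMixedDeriv_integral_liouville (hU : IsOpen U) (h0 : (0 : ℝ × ℝ) ∈ U)
    (hZ : ContDiffOn ℝ ∞ Z (U ×ˢ Icc 0 1)) (hZ0 : ∀ t : I, Z (0, t) = (x₀, 0))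
    (h₁ : ∀ t : I, cylDeriv U ((1, 0), 0) Z (0, t) = ζ₁ t)
    (h₂ : ∀ t : I, cylDeriv U ((0, 1), 0) Z (0, t) = ζ₂ t) :
    HasMixedDeriv (fun z => ∫ t : I, (Z (z, t)).2 (cylDeriv U (0, 1) Z (z, t)).1)
      (∫ t : I, ((ζ₁ t).2 (dt ζ₂ t).1 + (ζ₂ t).2 (dt ζ₁ t).1)) := by
  have hZt := contDiffOn_cylDeriv hU hZ (0, 1)
  have hmixed := hasMixedDeriv_integral_pairing hU h0 hZ.snd hZt.fst
    (fun t => by rw [hZ0 t]) fun t => by rw [cylDeriv_time_eq_zero hZ h0 hZ0]; rfl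
  refine hmixed.congr_value (integral_congr_ae (ae_of_all _ fun t => ?_))
  have hp : ((0 : ℝ × ℝ), (t : ℝ)) ∈ U ×ˢ Icc (0 : ℝ) 1 := ⟨h0, t.2⟩
  simp only [cylDeriv_snd hU hZ _ hp, cylDeriv_fst hU hZt _ hp, h₁, h₂,
    cylDeriv_cylDeriv_time hU hZ h0 h₁, cylDeriv_cylDeriv_time hU hZ h0 h₂]

theorem hasMixedDeriv_integral_quadratic (hU : IsOpen U) (h0 : (0 : ℝ × ℝ) ∈ U)
    (hZ : ContDiffOn ℝ ∞ Z (U ×ˢ Icc 0 1)) (hZ0 : ∀ t : I, Z (0, t) = (x₀, 0))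
    (h₁ : ∀ t : I, cylDeriv U ((1, 0), 0) Z (0, t) = ζ₁ t)
    (h₂ : ∀ t : I, cylDeriv U ((0, 1), 0) Z (0, t) = ζ₂ t)
    {O : Set E} {R : E → (E →L[ℝ] ℝ) →L[ℝ] E} (hR : ContDiffOn ℝ ∞ R O)
    (hO : ∀ p ∈ U ×ˢ Icc (0 : ℝ) 1, (Z p).1 ∈ O) :
    HasMixedDeriv (fun z => ∫ t : I, (Z (z, t)).2 (R (Z (z, t)).1 (Z (z, t)).2))
      (∫ t : I, ((ζ₁ t).2 (R x₀ (ζ₂ t).2) + (ζ₂ t).2 (R x₀ (ζ₁ t).2))) := by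
  have hRZ : ContDiffOn ℝ ∞ (fun p => R (Z p).1) (U ×ˢ Icc 0 1) := hR.comp hZ.fst hO
  have hmixed := hasMixedDeriv_integral_pairing hU h0 hZ.snd (hRZ.clm_apply hZ.snd)
    (fun t => by rw [hZ0 t]) fun t => by rw [hZ0 t, map_zero]
  refine hmixed.congr_value (integral_congr_ae (ae_of_all _ fun t => ?_))
  have hp : ((0 : ℝ × ℝ), (t : ℝ)) ∈ U ×ˢ Icc (0 : ℝ) 1 := ⟨h0, t.2⟩
  simp only [cylDeriv_clm_apply hU hRZ hZ.snd _ hp, cylDeriv_snd hU hZ _ hp, h₁, h₂, hZ0,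
    map_zero, add_zero]

end CanonicalCoordinates

section ChartFamily

variable {F : Type*} [NormedAddCommGroup F] [NormedSpace ℝ F]
  {H : Type*} [TopologicalSpace H] {J : ModelWithCorners ℝ F H}
  {M : Type*} [TopologicalSpace M] [ChartedSpace H M] {x : M}
  {P : Type*}

/-- A family of paths, extended to all times and read in the preferred chart at `x`. -/
def chartFamily (J : ModelWithCorners ℝ F H) (x : M) (Γ : P → I → M) (p : P × ℝ) : F :=
  extChartAt J x (IccExtend (zero_le_one (α := ℝ)) (Γ p.1) p.2)

theorem chartFamily_coe (J : ModelWithCorners ℝ F H) (x : M) (Γ : P → I → M) (z : P) (t : I) :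
    chartFamily J x Γ (z, t) = extChartAt J x (Γ z t) :=
  congrArg (extChartAt J x) (IccExtend_val _ _ t)

variable [NormedAddCommGroup P] [NormedSpace ℝ P] {U : Set P} {Γ : P → I → M}

theorem SmoothFamilyOn.smoothPath (hΓ : SmoothFamilyOn J U Γ) {z : P} (hz : z ∈ U) :
    SmoothPath J (Γ z) :=
  hΓ.comp (f := fun t : ℝ => (z, t)) (contMDiffOn_iff_contDiffOn.2 (by fun_prop))
    fun _ ht => ⟨hz, ht⟩

theorem SmoothFamilyOn.contMDiffOn_slice (hΓ : SmoothFamilyOn J U Γ) (t : I) :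
    ContMDiffOn 𝓘(ℝ, P) J ∞ (fun z => Γ z t) U := by
  have hslice : ContMDiffOn 𝓘(ℝ, P) J ∞
      (fun z => IccExtend (zero_le_one (α := ℝ)) (Γ z) t) U :=
    hΓ.comp (f := fun z : P => (z, (t : ℝ))) (contMDiffOn_iff_contDiffOn.2 (by fun_prop))
      fun _ hz => ⟨hz, t.2⟩
  simpa only [IccExtend_val] using hslice

theorem SmoothFamilyOn.exists_mem_chart_source (hU : IsOpen U) (hΓ : SmoothFamilyOn J U Γ)
    {z₀ : P} (hz₀ : z₀ ∈ U) (hx : ∀ t, Γ z₀ t = x) :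
    ∃ U', IsOpen U' ∧ z₀ ∈ U' ∧ SmoothFamilyOn J U' Γ ∧
      ∀ z ∈ U', ∀ t, Γ z t ∈ (extChartAt J x).source := by
  obtain ⟨U', hU', hz₀', hsub, hmaps⟩ := exists_isOpen_mapsTo_prod isCompact_Icc hU hz₀
    hΓ.continuousOn (O := (extChartAt J x).source) (isOpen_extChartAt_source x) fun t _ => by
      simpa only [IccExtend, Function.comp_apply, hx] using mem_extChartAt_source x
  refine ⟨U', hU', hz₀', hΓ.mono (prod_mono_left hsub), fun z hz t => ?_⟩
  simpa only [IccExtend_val] using hmaps (mk_mem_prod hz t.2)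

variable [IsManifold J ∞ M]

theorem SmoothFamilyOn.contDiffOn_chartFamily (hΓ : SmoothFamilyOn J U Γ)
    (hsrc : ∀ z ∈ U, ∀ t, Γ z t ∈ (extChartAt J x).source) :
    ContDiffOn ℝ ∞ (chartFamily J x Γ) (U ×ˢ Icc 0 1) := by
  rw [← contMDiffOn_iff_contDiffOn]
  refine (contMDiffOn_extChartAt (x := x)).comp hΓ fun p hp => ?_
  rw [← extChartAt_source J]
  exact hsrc p.1 hp.1 _

theorem SmoothFamilyOn.cylDeriv_chartFamily (hU : IsOpen U) (hΓ : SmoothFamilyOn J U Γ)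
    (hsrc : ∀ z ∈ U, ∀ t, Γ z t ∈ (extChartAt J x).source) (h0 : (0 : P) ∈ U) (e : P) {t : I}
    {v : TangentSpace J x}
    (hv : curveVelocity J (fun s => Γ (s • e) t) 0 = (⟨x, v⟩ : TangentBundle J M)) :
    cylDeriv U (e, 0) (chartFamily J x Γ) (0, t) = v := by
  have h0' : (0 : P) + (0 : ℝ) • e ∈ U := by simpa using h0
  have hcyl := hasDerivAt_cylDeriv hU t.2 e 0 (s := 0) h0'
    ((hΓ.contDiffOn_chartFamily hsrc).differentiableOn (by simp) _ ⟨h0', t.2⟩)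
  have hline : Continuous fun s : ℝ => s • e := by fun_prop
  have hsmooth : ContMDiffAt 𝓘(ℝ, ℝ) J ∞ (fun s : ℝ => Γ (s • e) t) 0 :=
    ((hΓ.contMDiffOn_slice t).comp (f := fun s : ℝ => s • e) (s := (· • e) ⁻¹' U)
      (contMDiffOn_iff_contDiffOn.2 (by fun_prop)) fun _ hs => hs).contMDiffAt
      (hline.continuousAt.preimage_mem_nhds (hU.mem_nhds (by simpa using h0)))
  simp only [zero_smul, zero_add, chartFamily_coe] at hcyl
  exact hcyl.unique ((curveVelocity_eq_iff_self hsmooth v).1 hv).2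

end ChartFamily

section Action

variable {n : ℕ} {N : Type*} [TopologicalSpace N] [ChartedSpace (Model n) N]
  [IsManifold (𝓡 n) ∞ N] {q : N}

theorem liouville_velocity {γ : I → Cotangent n N} (hγ : SmoothPath (cotI n) γ) {t : I}
    (ht : γ t ∈ (covChart q).source) :
    liouville (γ t) (velocity (cotI n) γ t) = (covChart q (γ t)).2
      (dt (covChart q ∘ IccExtend (zero_le_one (α := ℝ)) γ) t).1 := by
  rw [liouville_eq (mem_covChart_source.1 ht)]
  set c := IccExtend (zero_le_one (α := ℝ)) γ
  have hct : c t = γ t := IccExtend_val _ _ t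
  have hchart : MDifferentiableAt (cotI n) 𝓘(ℝ, CotModel n) (covChart q) (c t) :=
    mdifferentiableAt_covChart (hct.symm ▸ mem_covChart_source.1 ht)
  have hcomp := hchart.hasMFDerivAt.comp_hasMFDerivWithinAt (t : ℝ)
    (hγ.mdifferentiableOn (by simp) (t : ℝ) t.2).hasMFDerivWithinAt
  let L : ℝ →L[ℝ] CotModel n := (mfderiv (cotI n) 𝓘(ℝ, CotModel n) (covChart q) (c t)).comp
    (mfderivWithin 𝓘(ℝ, ℝ) (cotI n) c (Icc 0 1) t)
  have hL : HasFDerivWithinAt (covChart q ∘ c) L (Icc 0 1) t := hcomp.hasFDerivWithinAt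
  have hderiv : (mfderiv (cotI n) 𝓘(ℝ, CotModel n) (covChart q) (γ t) :
      CotModel n →L[ℝ] CotModel n) = mfderiv (cotI n) 𝓘(ℝ, CotModel n) (covChart q) (c t) := by
    rw [hct]
  rw [dt_eq_of_hasDerivWithinAt hL.hasDerivWithinAt]
  exact congrArg (fun A : CotModel n →L[ℝ] CotModel n => (covChart q (γ t)).2
    (A (mfderivWithin 𝓘(ℝ, ℝ) (cotI n) c (Icc 0 1) t (1 : ℝ))).1) hderiv

/-- The second variation of the action at the constant path at the zero covector over `q`. -/
def secondVariation (g : RiemMetric n N) (q : N) (ξ₁ ξ₂ : Fields n q) : ℝ :=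
  linHess (metricEquiv g q) (fieldExt ξ₁) (fieldExt ξ₂)

variable (g : RiemMetric n N)

theorem action_eq {P : Type*} [NormedAddCommGroup P] [NormedSpace ℝ P] {U : Set P}
    {Γ : P → I → Cotangent n N} (hΓ : SmoothFamilyOn (cotI n) U Γ)
    (hsrc : ∀ z ∈ U, ∀ t, Γ z t ∈ (covChart q).source) {z : P} (hz : z ∈ U) :
    action g (Γ z) =
      -(∫ t : I, (chartFamily (cotI n) (zeroCov q) Γ (z, t)).2
        (cylDeriv U (0, 1) (chartFamily (cotI n) (zeroCov q) Γ) (z, t)).1) +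
      ∫ t : I, localKinetic g q (chartFamily (cotI n) (zeroCov q) Γ (z, t)) := by
  have hZ := hΓ.contDiffOn_chartFamily hsrc
  simp only [action, ← dt_slice hZ hz, chartFamily_coe,
    liouville_velocity (hΓ.smoothPath hz) (hsrc z hz _),
    kinetic_eq_localKinetic g (mem_covChart_source.1 (hsrc z hz _))]
  rfl

theorem hasMixedDeriv_integral_localKinetic {U : Set (ℝ × ℝ)} (hU : IsOpen U)
    (h0 : (0 : ℝ × ℝ) ∈ U) {Z : (ℝ × ℝ) × ℝ → CotModel n} {ζ₁ ζ₂ : ℝ → CotModel n}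
    (hZ : ContDiffOn ℝ ∞ Z (U ×ˢ Icc 0 1))
    (hZ0 : ∀ t : I, Z (0, t) = (chartAt (Model n) q q, 0))
    (htarget : ∀ p ∈ U ×ˢ Icc (0 : ℝ) 1, (Z p).1 ∈ (chartAt (Model n) q).target)
    (h₁ : ∀ t : I, cylDeriv U ((1, 0), 0) Z (0, t) = ζ₁ t)
    (h₂ : ∀ t : I, cylDeriv U ((0, 1), 0) Z (0, t) = ζ₂ t) :
    HasMixedDeriv (fun z => ∫ t : I, localKinetic g q (Z (z, t)))
      (∫ t : I, (ζ₁ t).2 ((metricEquiv g q).symm (ζ₂ t).2)) := by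
  have hmixed := hasMixedDeriv_integral_quadratic hU h0 hZ hZ0 h₁ h₂
    ((contDiffOn_localSharp g q).const_smul (1 / 2 : ℝ)) htarget
  simp only [smul_apply, map_smul, localSharp_self, smul_eq_mul] at hmixed
  refine hmixed.congr_value (integral_congr_ae (ae_of_all _ fun t => ?_))
  simp only [(isScalarProduct_metricEquiv g q).apply_symm_comm (ζ₂ t).2]
  ring

theorem hasMixedDeriv_action {L : Set (Cotangent n N)} {ξ₁ ξ₂ : Fields n q}
    (h₁ : ContDiffOn ℝ ∞ (fieldExt ξ₁) (Icc 0 1)) (h₂ : ContDiffOn ℝ ∞ (fieldExt ξ₂) (Icc 0 1))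
    {Γ : ℝ × ℝ → I → Cotangent n N} (hΓ : IsVariation (cotI n) L (constPath n q) ξ₁ ξ₂ Γ) :
    HasMixedDeriv (fun z => action g (Γ z)) (secondVariation g q ξ₁ ξ₂) := by
  obtain ⟨⟨U₀, hU₀, h0U₀, hΓ₀, -⟩, hv₁, hv₂⟩ := hΓ
  have hbase : ∀ t, Γ 0 t = zeroCov q := fun t => congrArg TotalSpace.proj (hv₁ t)
  obtain ⟨U, hU, h0, hΓU, hsrc⟩ := hΓ₀.exists_mem_chart_source hU₀ h0U₀ hbase
  set Z := chartFamily (cotI n) (zeroCov q) Γ with hZdef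
  have hZ : ContDiffOn ℝ ∞ Z (U ×ˢ Icc 0 1) := hΓU.contDiffOn_chartFamily hsrc
  have hZ0 : ∀ t : I, Z (0, t) = (chartAt (Model n) q q, 0) := fun t => by
    rw [hZdef, chartFamily_coe, hbase, ← covChart_zeroCov q q]
  have htarget : ∀ p ∈ U ×ˢ Icc (0 : ℝ) 1, (Z p).1 ∈ (chartAt (Model n) q).target := fun p hp => by
    have hmem := (covChart q).map_source (hsrc p.1 hp.1 (projIcc 0 1 zero_le_one p.2))
    rw [covChart_target] at hmem
    exact hmem.1
  have hZ₁ : ∀ t : I, cylDeriv U ((1, 0), 0) Z (0, t) = fieldExt ξ₁ t := fun t =>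
    (hΓU.cylDeriv_chartFamily hU hsrc h0 (1, 0) (by simpa [constPath] using hv₁ t)).trans
      (fieldExt_coe (J := cotI n) (x := zeroCov q) ξ₁ t).symm
  have hZ₂ : ∀ t : I, cylDeriv U ((0, 1), 0) Z (0, t) = fieldExt ξ₂ t := fun t =>
    (hΓU.cylDeriv_chartFamily hU hsrc h0 (0, 1) (by simpa [constPath] using hv₂ t)).trans
      (fieldExt_coe (J := cotI n) (x := zeroCov q) ξ₂ t).symm
  refine (((hasMixedDeriv_integral_liouville hU h0 hZ hZ0 hZ₁ hZ₂).neg.add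
    (hasMixedDeriv_integral_localKinetic g hU h0 hZ hZ0 htarget hZ₁ hZ₂)).congr_value ?_).congr
    (eventually_of_mem (hU.mem_nhds h0) fun z hz => action_eq g hΓU hsrc hz)
  rw [secondVariation, linHess, ← integral_neg, ← integral_add]
  · exact (integrable_of_contDiffOn ((h₁.snd.clm_apply (contDiffOn_dt h₂).fst).add
      (h₂.snd.clm_apply (contDiffOn_dt h₁).fst))).neg
  · exact integrable_of_contDiffOn
      (h₁.snd.clm_apply ((metricEquiv g q).symm.contDiff.comp_contDiffOn h₂.snd))

theorem SliceChart.isHessian {T : Set N} {V : Submodule ℝ (Model n)}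
    (s : SliceChart (𝓡 n) T q V) :
    IsHessian (cotI n) (action g) (conormal T) (constPath n q) (secondVariation g q) :=
  fun _ h₁ _ h₂ => ⟨s.conormalChart.exists_isVariation h₁ h₂, fun _ hΓ =>
    hasMixedDeriv_action g ((s.conormalChart.mem_pathTangent_iff _).1 h₁).1
      ((s.conormalChart.mem_pathTangent_iff _).1 h₂).1 hΓ⟩

end Action

/-! ### Constant chords -/

section CriticalPoints

variable {F : Type*} [NormedAddCommGroup F] [NormedSpace ℝ F]
  {H : Type*} [TopologicalSpace H] {J : ModelWithCorners ℝ F H}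
  {M : Type*} [TopologicalSpace M] [ChartedSpace H M]

theorem mfderiv_eq_zero_of_isLocalMin [J.Boundaryless] {f : M → ℝ} {x : M} (hf : IsLocalMin f x) :
    mfderiv J 𝓘(ℝ, ℝ) f x = 0 := by
  by_cases hd : MDifferentiableAt J 𝓘(ℝ, ℝ) f x
  · have hmin : IsLocalMin (f ∘ (extChartAt J x).symm) (extChartAt J x x) := by
      have hsymm : Tendsto (extChartAt J x).symm (𝓝 (extChartAt J x x)) (𝓝 x) := by
        simpa [ContinuousAt] using continuousAt_extChartAt_symm x
      simpa [IsLocalMin, IsMinFilter] using hsymm.eventually hf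
    rw [hd.mfderiv, J.range_eq_univ, fderivWithin_univ]
    exact hmin.fderiv_eq_zero
  · exact mfderiv_zero_of_not_mdifferentiableAt hd

theorem curveVelocity_congr {c c' : ℝ → M} {s : ℝ} (h : c =ᶠ[𝓝 s] c') :
    curveVelocity J c s = curveVelocity J c' s := by
  have hderiv : mfderiv 𝓘(ℝ, ℝ) J c s = mfderiv 𝓘(ℝ, ℝ) J c' s := h.mfderiv_eq
  exact TotalSpace.ext h.eq_of_nhds (heq_of_eq (congrArg (fun A : ℝ →L[ℝ] F => A 1) hderiv))

theorem velocity_const (x : M) (t : I) : velocity J (fun _ : I => x) t = 0 := by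
  have hzero : mfderivWithin 𝓘(ℝ, ℝ) J (fun _ : ℝ => x) (Icc 0 1) (t : ℝ) = 0 := mfderivWithin_const
  exact congrArg (fun A : ℝ →L[ℝ] F => A 1) hzero

end CriticalPoints

section ConstantChords

variable {n : ℕ} {N : Type*} [TopologicalSpace N] [ChartedSpace (Model n) N]
  [IsManifold (𝓡 n) ∞ N]

theorem contMDiff_zeroCov : ContMDiff (𝓡 n) (cotI n) ∞ (zeroCov (n := n) (N := N)) :=
  Bundle.contMDiff_zeroSection ℝ _

theorem mdifferentiable_fibreLine (x : Cotangent n N) :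
    MDifferentiable 𝓘(ℝ, ℝ) (cotI n) fun r : ℝ => (⟨x.1, r • x.2⟩ : Cotangent n N) := by
  intro r₀
  refine (mdifferentiableAt_totalSpace _ _).2 ⟨mdifferentiableAt_const, ?_⟩
  have hlin (r : ℝ) : (trivializationAt (Model n →L[ℝ] ℝ)
      (fun q : N => TangentSpace (𝓡 n) q →L[ℝ] Bundle.Trivial N ℝ q) x.1 ⟨x.1, r • x.2⟩).2 =
        r • (trivializationAt (Model n →L[ℝ] ℝ)
          (fun q : N => TangentSpace (𝓡 n) q →L[ℝ] Bundle.Trivial N ℝ q) x.1 x).2 :=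
    ((trivializationAt (Model n →L[ℝ] ℝ)
      (fun q : N => TangentSpace (𝓡 n) q →L[ℝ] Bundle.Trivial N ℝ q) x.1).linear ℝ
        (FiberBundle.mem_baseSet_trivializationAt' x.1)).map_smul r x.2
  simp only [hlin]
  exact (by fun_prop : Differentiable ℝ _).mdifferentiable.mdifferentiableAt

variable (g : RiemMetric n N)

theorem kinetic_nonneg (x : Cotangent n N) : 0 ≤ kinetic g x :=
  mul_nonneg (by norm_num) ((isScalarProduct_metricEquiv g x.1).nonneg _)

theorem kinetic_smul (x : Cotangent n N) (r : ℝ) :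
    kinetic g ⟨x.1, r • x.2⟩ = r ^ 2 * kinetic g x := by
  have hcov : covec (⟨x.1, r • x.2⟩ : Cotangent n N) = r • covec x := rfl
  simp only [kinetic_eq, hcov, map_smul, smul_apply, smul_eq_mul]
  ring

theorem kinetic_zeroCov (q : N) : kinetic g (zeroCov q) = 0 := by
  rw [kinetic_eq, show covec (zeroCov (n := n) q) = 0 from rfl]
  simp

theorem eq_zeroCov_of_kinetic_eq_zero {x : Cotangent n N} (hx : kinetic g x = 0) :
    x = zeroCov x.1 := by
  rw [kinetic_eq] at hx
  have hcov : covec x = 0 :=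
    (isScalarProduct_metricEquiv g x.1).eq_zero_of_apply_symm_self (by linarith)
  exact congrArg (TotalSpace.mk x.1) hcov

theorem mfderiv_kinetic_eq_zero_iff {x : Cotangent n N} :
    mfderiv (cotI n) 𝓘(ℝ, ℝ) (kinetic g) x = 0 ↔ x = zeroCov x.1 := by
  refine ⟨fun hx => eq_zeroCov_of_kinetic_eq_zero g ?_, fun hx => ?_⟩
  · set c : ℝ → Cotangent n N := fun r => ⟨x.1, r • x.2⟩ with hc
    have hkinetic : ∀ y, y = x → HasMFDerivAt (cotI n) 𝓘(ℝ, ℝ) (kinetic g) y 0 := by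
      rintro _ rfl
      exact hx ▸ ((contMDiff_kinetic g).mdifferentiable (by simp) _).hasMFDerivAt
    have hcomp := (hkinetic (c 1) (congrArg (TotalSpace.mk x.1) (one_smul ℝ x.2))).comp (1 : ℝ)
      (mdifferentiable_fibreLine x 1).hasMFDerivAt
    have hzero : HasFDerivAt (kinetic g ∘ c) (0 : ℝ →L[ℝ] ℝ) 1 :=
      (hcomp.congr_mfderiv (ContinuousLinearMap.zero_comp _)).hasFDerivAt
    have hquad : HasDerivAt (kinetic g ∘ c) (2 * kinetic g x) 1 := by
      have hpow := (hasDerivAt_pow 2 (1 : ℝ)).mul_const (kinetic g x)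
      simpa [Function.comp_def, hc, kinetic_smul] using hpow
    linarith [hquad.unique (by simpa using hzero.hasDerivAt)]
  · rw [hx]
    exact mfderiv_eq_zero_of_isLocalMin <| Eventually.of_forall fun y => by
      rw [kinetic_zeroCov]
      exact kinetic_nonneg g y

theorem mem_chords_const_iff {L : Set (Cotangent n N)} {x : Cotangent n N} :
    (fun _ => x) ∈ chords g L ↔ x ∈ L ∧ x = zeroCov x.1 := by
  have hsymp (t : I) (ζ : TangentSpace (cotI n) x) :
      symp x (velocity (cotI n) (fun _ : I => x) t) ζ = 0 := by
    rw [velocity_const]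
    exact (by simp [symp] : symp x (0 : CotModel n) ζ = 0)
  rw [← mfderiv_kinetic_eq_zero_iff g]
  constructor
  · rintro ⟨⟨-, hL, -⟩, hchord⟩
    exact ⟨hL, ContinuousLinearMap.ext fun ζ => (hchord 0 ζ).symm.trans (hsymp 0 ζ)⟩
  · rintro ⟨hL, hcrit⟩
    exact ⟨⟨contMDiffOn_const, hL, hL⟩, fun t ζ => (hsymp t ζ).trans (by rw [hcrit]; rfl)⟩

theorem constChords_conormal (T : Set N) :
    constChords g (conormal T) = {γ | ∃ q ∈ T, ∀ t, γ t = zeroCov q} := by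
  ext γ
  constructor
  · rintro ⟨hchord, x, hx⟩
    obtain rfl : γ = fun _ => x := funext hx
    obtain ⟨hxT, hx0⟩ := (mem_chords_const_iff g).1 hchord
    exact ⟨x.1, hxT.1, fun _ => hx0⟩
  · rintro ⟨q, hq, hγ⟩
    obtain rfl : γ = fun _ => zeroCov q := funext hγ
    exact ⟨(mem_chords_const_iff g).2 ⟨⟨hq, fun _ _ => rfl⟩, rfl⟩, zeroCov q, hγ⟩

theorem smoothFamilyOn_constPath_iff {P : Type*} [NormedAddCommGroup P] [NormedSpace ℝ P]
    {U : Set P} {f : P → N} :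
    SmoothFamilyOn (cotI n) U (fun s => constPath n (f s)) ↔ ContMDiffOn 𝓘(ℝ, P) (𝓡 n) ∞ f U := by
  constructor
  · exact fun hf => (contMDiff_proj _).comp_contMDiffOn (hf.contMDiffOn_slice 0)
  · intro hf
    have hfst : ContMDiffOn 𝓘(ℝ, P × ℝ) (𝓡 n) ∞ (fun z : P × ℝ => f z.1) (U ×ˢ Icc 0 1) :=
      hf.comp contDiff_fst.contMDiff.contMDiffOn fun _ hz => hz.1
    exact contMDiff_zeroCov.comp_contMDiffOn hfst

theorem isDiffeoOnto_constPath (T : Set N) :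
    IsDiffeoOnto T (constChords g (conormal T)) (constPath n) := by
  rw [constChords_conormal]
  refine ⟨⟨fun q hq => ⟨q, hq, fun _ => rfl⟩, fun q _ q' _ h => ?_, ?_⟩,
    fun m U f _ _ => smoothFamilyOn_constPath_iff.symm⟩
  · exact congrArg TotalSpace.proj (congrFun h 0)
  · rintro γ ⟨q, hq, hγ⟩
    exact ⟨q, hq, (funext hγ).symm⟩

theorem curveVelocity_zeroCov {q : N} {c : ℝ → N} {v : Model n}
    (hc : ContMDiffAt 𝓘(ℝ, ℝ) (𝓡 n) ∞ c 0)
    (hv : curveVelocity (𝓡 n) c 0 = (⟨q, v⟩ : TangentBundle (𝓡 n) N)) :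
    curveVelocity (cotI n) (fun r => zeroCov (n := n) (c r)) 0 =
      (⟨zeroCov q, ((v, 0) : CotModel n)⟩ : TangentBundle (cotI n) (Cotangent n N)) := by
  obtain ⟨hc0, hderiv⟩ := (curveVelocity_eq_iff_self hc v).1 hv
  refine (curveVelocity_eq_iff_self (contMDiff_zeroCov.contMDiffAt.comp (0 : ℝ) hc) _).2
    ⟨congrArg zeroCov hc0, ?_⟩
  refine (hderiv.prodMk (hasDerivAt_const _ (0 : Model n →L[ℝ] ℝ))).congr_of_eventuallyEq ?_
  exact Eventually.of_forall fun r => covChart_zeroCov q (c r)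

theorem mem_familyTangent_constChords_iff {T : Set N} {q : N} {ξ : Fields n q} :
    ξ ∈ familyTangent (cotI n) (constChords g (conormal T)) (constPath n q) ↔
      ∃ v : TangentSpace (𝓡 n) q, IsTangentTo (𝓡 n) T q v ∧ ∀ t, ξ t = ((v, 0) : CotModel n) := by
  rw [constChords_conormal]
  constructor
  · rintro ⟨Γ, U, hU, h0, hΓ, hmem, hξ⟩
    set c : ℝ → N := fun r => (Γ r 0).1
    have hcU : ∀ r ∈ U, c r ∈ T ∧ Γ r = constPath n (c r) := by
      intro r hr
      obtain ⟨y, hy, hΓy⟩ := hmem r hr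
      obtain rfl : c r = y := congrArg TotalSpace.proj (hΓy 0)
      exact ⟨hy, funext hΓy⟩
    have hcsmooth : ContMDiffOn 𝓘(ℝ, ℝ) (𝓡 n) ∞ c U :=
      (contMDiff_proj _).comp_contMDiffOn (hΓ.contMDiffOn_slice 0)
    obtain ⟨v, hv⟩ : ∃ v : TangentSpace (𝓡 n) q,
        curveVelocity (𝓡 n) c 0 = (⟨q, v⟩ : TangentBundle (𝓡 n) N) := by
      have hc0 : c 0 = q := congrArg (fun y => y.1.1) (hξ 0)
      rw [← hc0]
      exact ⟨_, rfl⟩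
    refine ⟨v, ⟨c, U, hU, h0, hcsmooth, fun r hr => (hcU r hr).1, hv⟩, fun t => ?_⟩
    have hnear : (fun r => Γ r t) =ᶠ[𝓝 0] fun r => zeroCov (c r) :=
      eventually_of_mem (hU.mem_nhds h0) fun r hr => congrFun (hcU r hr).2 t
    have hvelocity := (hξ t).symm.trans ((curveVelocity_congr hnear).trans
      (curveVelocity_zeroCov (hcsmooth.contMDiffAt (hU.mem_nhds h0)) hv))
    exact TotalSpace.mk_injective _ hvelocity
  · rintro ⟨v, ⟨c, U, hU, h0, hc, hcT, hv⟩, hξ⟩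
    refine ⟨fun r => constPath n (c r), U, hU, h0, smoothFamilyOn_constPath_iff.2 hc,
      fun r hr => ⟨c r, hcT r hr, fun _ => rfl⟩, fun t => ?_⟩
    rw [hξ]
    exact curveVelocity_zeroCov (hc.contMDiffAt (hU.mem_nhds h0)) hv

end ConstantChords

/-! ### Nondegeneracy -/

section LinearModel

variable {E : Type*} [NormedAddCommGroup E] [NormedSpace ℝ E] {G : E ≃L[ℝ] (E →L[ℝ] ℝ)}

theorem linHess_congr_right {ζ ζ₁ ζ₂ : ℝ → E × (E →L[ℝ] ℝ)} (h : ∀ t : I, ζ₁ t = ζ₂ t) :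
    linHess G ζ ζ₁ = linHess G ζ ζ₂ :=
  integral_congr_ae (ae_of_all _ fun t => by simp only [dt_congr h t, h t])

theorem hessOp_congr {ζ₁ ζ₂ : ℝ → E × (E →L[ℝ] ℝ)} (h : ∀ t : I, ζ₁ t = ζ₂ t) (t : I) :
    hessOp G ζ₁ t = hessOp G ζ₂ t := by
  simp only [hessOp, dt_congr h t, h t]

theorem hessOp_of_eq_const {ζ : ℝ → E × (E →L[ℝ] ℝ)} {v : E} (h : ∀ t : I, ζ t = (v, 0)) (t : I) :
    hessOp G ζ t = 0 := by
  have hd : dt ζ t = 0 := (dt_congr (f₁ := fun _ => (v, 0)) h t).trans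
    (dt_eq_of_hasDerivWithinAt (hasDerivWithinAt_const _ _ _))
  simp [hessOp, hd, h t]

theorem IsAdmissible.congr {F : Type*} [NormedAddCommGroup F] [NormedSpace ℝ F]
    {V : Submodule ℝ F} {ζ₁ ζ₂ : ℝ → F} (h₁ : IsAdmissible V ζ₁) (h : ∀ t : I, ζ₂ t = ζ₁ t) :
    IsAdmissible V ζ₂ :=
  ⟨h₁.1.congr fun t ht => h ⟨t, ht⟩, (h 0).symm ▸ h₁.2.1, (h 1).symm ▸ h₁.2.2⟩

/-- `P` is the pairing `⟨A ·, ·⟩` for the Sasaki scalar product, where `A` is symmetric up to the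
sign `ε` and `A² = ε`.  This treats at once the Sasaki metric (`A = 1`, `ε = 1`) and the symplectic
form (`A` an almost complex structure, `ε = -1`). -/
structure IsSasakiPairing (G : E ≃L[ℝ] (E →L[ℝ] ℝ))
    (P : E × (E →L[ℝ] ℝ) → E × (E →L[ℝ] ℝ) → ℝ)
    (A : E × (E →L[ℝ] ℝ) →L[ℝ] E × (E →L[ℝ] ℝ)) (ε : ℝ) : Prop where
  eq_linSasaki : ∀ x y, P x y = linSasaki G (A x) y
  linSasaki_apply_left : ∀ x y, linSasaki G (A x) y = ε * linSasaki G x (A y)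
  apply_apply : ∀ x, A (A x) = ε • x
  sign_ne_zero : ε ≠ 0

theorem isSasakiPairing_linSasaki (G : E ≃L[ℝ] (E →L[ℝ] ℝ)) :
    IsSasakiPairing G (fun x y => linSasaki G x y) (ContinuousLinearMap.id ℝ _) 1 where
  eq_linSasaki _ _ := rfl
  linSasaki_apply_left _ _ := (one_mul _).symm
  apply_apply _ := (one_smul ℝ _).symm
  sign_ne_zero := one_ne_zero

/-- The almost complex structure of `E × E*` relating the canonical symplectic form to the Sasaki
scalar product. -/
def sasakiJ (G : E ≃L[ℝ] (E →L[ℝ] ℝ)) : E × (E →L[ℝ] ℝ) →L[ℝ] E × (E →L[ℝ] ℝ) :=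
  (-(G.symm.toContinuousLinearMap ∘L ContinuousLinearMap.snd ℝ E (E →L[ℝ] ℝ))).prod
    (G.toContinuousLinearMap ∘L ContinuousLinearMap.fst ℝ E (E →L[ℝ] ℝ))

theorem sasakiJ_apply (x : E × (E →L[ℝ] ℝ)) : sasakiJ G x = (-G.symm x.2, G x.1) := rfl

theorem IsScalarProduct.isSasakiPairing_symplectic (hG : IsScalarProduct G) :
    IsSasakiPairing G (fun x y => y.2 x.1 - x.2 y.1) (sasakiJ G) (-1) where
  eq_linSasaki x y := by
    simp only [linSasaki_apply, sasakiJ_apply, map_neg, neg_apply,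
      ContinuousLinearEquiv.apply_symm_apply]
    rw [hG.symm x.1, ContinuousLinearEquiv.apply_symm_apply]
    ring
  linSasaki_apply_left x y := by
    simp only [linSasaki_apply, sasakiJ_apply, map_neg, neg_apply,
      ContinuousLinearEquiv.apply_symm_apply, ContinuousLinearEquiv.symm_apply_apply]
    ring
  apply_apply x := by simp [sasakiJ_apply, Prod.ext_iff, neg_one_smul ℝ x.2]
  sign_ne_zero := by norm_num

namespace IsSasakiPairing

variable {P : E × (E →L[ℝ] ℝ) → E × (E →L[ℝ] ℝ) → ℝ}
  {A : E × (E →L[ℝ] ℝ) →L[ℝ] E × (E →L[ℝ] ℝ)} {ε : ℝ} {x y : E × (E →L[ℝ] ℝ)}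

theorem apply_inv_smul (hP : IsSasakiPairing G P A ε) : P (ε⁻¹ • A x) y = linSasaki G x y := by
  rw [hP.eq_linSasaki, map_smul, hP.apply_apply, smul_smul, inv_mul_cancel₀ hP.sign_ne_zero,
    one_smul]

theorem linSasaki_inv_smul (hP : IsSasakiPairing G P A ε) :
    linSasaki G (ε⁻¹ • A x) y = linSasaki G x (A y) := by
  rw [linSasaki_smul, hP.linSasaki_apply_left,
    inv_mul_cancel_left₀ hP.sign_ne_zero]

theorem eq_zero_of_apply_eq_zero (hP : IsSasakiPairing G P A ε) (hx : A x = 0) : x = 0 := by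
  have hsmul := hP.apply_apply x
  rw [hx, map_zero] at hsmul
  exact (smul_eq_zero.1 hsmul.symm).resolve_left hP.sign_ne_zero

theorem ae_eq_zero_of_cokernel [FiniteDimensional ℝ E] (hP : IsSasakiPairing G P A ε)
    (hG : IsScalarProduct G) {V : Submodule ℝ E} {η : I → E × (E →L[ℝ] ℝ)} (hη : Integrable η)
    (hcoker : ∀ ζ, IsAdmissible (linConormal V) ζ →
      ∫ t : I, linSasaki G (ε⁻¹ • A (hessOp G ζ t)) (η t) = 0)
    (hann : ∀ v ∈ V, ∫ t : I, P (v, 0) (η t) = 0) : η =ᵐ[volume] 0 := by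
  have hAη := ConormalChords.ae_eq_zero_of_cokernel hG (V := V) (A.integrable_comp hη)
    (fun ζ hζ => by simpa only [hP.linSasaki_inv_smul] using hcoker ζ hζ) fun v hv => by
      simpa only [hP.eq_linSasaki, hP.linSasaki_apply_left, integral_const_mul, mul_eq_zero,
        hP.sign_ne_zero, false_or] using hann v hv
  filter_upwards [hAη] with t ht using hP.eq_zero_of_apply_eq_zero ht

end IsSasakiPairing

end LinearModel

theorem exists_Lp_ae_eq_of_continuous {X Y F : Type*} [TopologicalSpace X] [CompactSpace X]
    [MeasurableSpace X] [OpensMeasurableSpace X] {μ : Measure X} [IsFiniteMeasureOnCompacts μ]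
    [NormedAddCommGroup F] (p : ENNReal) {S : Set Y}
    {f : Y → X → F} (hf : ∀ y ∈ S, Continuous (f y)) :
    ∃ D : Y → Lp F p μ, ∀ y ∈ S, D y =ᵐ[μ] f y := by
  have hmem (y : S) : MemLp (f y) p μ :=
    (hf y y.2).memLp_of_hasCompactSupport (HasCompactSupport.of_compactSpace _)
  classical
  exact ⟨fun y => if hy : y ∈ S then (hmem ⟨y, hy⟩).toLp else 0, fun y hy => by
    simpa only [dif_pos hy] using (hmem ⟨y, hy⟩).coeFn_toLp⟩

section Nondegenerate

variable {n : ℕ} {N : Type*} [TopologicalSpace N] [ChartedSpace (Model n) N]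
  [IsManifold (𝓡 n) ∞ N] (g : RiemMetric n N)

theorem sasaki_eq (q : N) (x y : CotModel n) :
    sasaki g q x y = linSasaki (metricEquiv g q) x y := by
  rw [linSasaki_apply, metricEquiv_symm_apply]
  exact congrArg (fun α : Model n →L[ℝ] ℝ => g.inner q x.1 y.1 + α (sharp g q y.2))
    (inner_sharp g q x.2)

/-- The restriction to the unit interval of a vector field on the line. -/
def fieldOf (q : N) (ζ : ℝ → CotModel n) : Fields n q := fun t : I => ζ t

theorem fieldExt_fieldOf (q : N) (ζ : ℝ → CotModel n) (t : I) : fieldExt (fieldOf q ζ) t = ζ t :=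
  IccExtend_val _ _ t

namespace SliceChart

variable {T : Set N} {q : N} {V : Submodule ℝ (Model n)} (s : SliceChart (𝓡 n) T q V)

include s

theorem mem_familyTangent_iff (ξ : Fields n q) :
    ξ ∈ familyTangent (cotI n) (constChords g (conormal T)) (constPath n q) ↔
      ∃ v ∈ V, ∀ t : I, fieldExt ξ t = (v, 0) := by
  rw [mem_familyTangent_constChords_iff]
  refine exists_congr fun v => and_congr (s.isTangentTo_base_iff v) (forall_congr' fun t => ?_)
  exact (fieldExt_coe (J := cotI n) (x := zeroCov q) ξ t).symm ▸ Iff.rfl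

theorem fieldOf_mem_pathTangent {ζ : ℝ → CotModel n} (hζ : IsAdmissible (linConormal V) ζ) :
    fieldOf q ζ ∈ pathTangent (cotI n) (conormal T) (constPath n q) :=
  (s.conormalChart.mem_pathTangent_iff _).2 (hζ.congr (fieldExt_fieldOf q ζ))

theorem secondVariation_eq_integral_hessOp {ξ₁ ξ₂ : Fields n q}
    (h₁ : ξ₁ ∈ pathTangent (cotI n) (conormal T) (constPath n q))
    (h₂ : ξ₂ ∈ pathTangent (cotI n) (conormal T) (constPath n q)) :
    secondVariation g q ξ₁ ξ₂ =
      ∫ t : I, linSasaki (metricEquiv g q) (hessOp (metricEquiv g q) (fieldExt ξ₁) t)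
        (fieldExt ξ₂ t) :=
  linHess_eq_integral_hessOp (isScalarProduct_metricEquiv g q)
    ((s.conormalChart.mem_pathTangent_iff ξ₁).1 h₁) ((s.conormalChart.mem_pathTangent_iff ξ₂).1 h₂)

theorem hessianKernel_eq :
    hessianKernel (cotI n) (conormal T) (constPath n q) (secondVariation g q) =
      familyTangent (cotI n) (constChords g (conormal T)) (constPath n q) := by
  have hG := isScalarProduct_metricEquiv g q
  ext ξ
  rw [s.mem_familyTangent_iff]
  constructor
  · rintro ⟨hξ, hker⟩
    have hadm := (s.conormalChart.mem_pathTangent_iff ξ).1 hξ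
    obtain ⟨hv, hconst⟩ := eq_const_of_hessOp_eq_zero hG hadm
      (hessOp_eq_zero_of_forall_linHess_eq_zero hG hadm fun ζ hζ =>
        (linHess_congr_right (fieldExt_fieldOf q ζ)).symm.trans
          (hker _ (s.fieldOf_mem_pathTangent hζ)))
    exact ⟨_, hv, hconst⟩
  · rintro ⟨v, hv, hconst⟩
    have hadm : IsAdmissible (linConormal V) (fieldExt ξ) := IsAdmissible.congr
      (ζ₁ := fun _ => (v, 0)) ⟨contDiffOn_const, ⟨hv, fun _ _ => rfl⟩, ⟨hv, fun _ _ => rfl⟩⟩ hconst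
    have hξ := (s.conormalChart.mem_pathTangent_iff ξ).2 hadm
    refine ⟨hξ, fun ξ₂ h₂ => ?_⟩
    rw [s.secondVariation_eq_integral_hessOp g hξ h₂]
    simp [hessOp_of_eq_const hconst, linSasaki_apply]

theorem exists_operator {P : CotModel n → CotModel n → ℝ} {A : CotModel n →L[ℝ] CotModel n} {ε : ℝ}
    (hP : IsSasakiPairing (metricEquiv g q) P A ε) :
    ∃ D : Fields n q → L2Fields n,
      Represents (conormal T) q P (secondVariation g q) D ∧
      cokernel g (conormal T) q D ∩ annihilator q P
        (familyTangent (cotI n) (constChords g (conormal T)) (constPath n q)) = {0} := by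
  have hG := isScalarProduct_metricEquiv g q
  obtain ⟨D, hD⟩ := exists_Lp_ae_eq_of_continuous (μ := (volume : Measure I)) 2
    (f := fun ξ t => ε⁻¹ • A (hessOp (metricEquiv g q) (fieldExt ξ) t)) fun ξ hξ =>
      (A.continuous.comp (contDiffOn_hessOp
        ((s.conormalChart.mem_pathTangent_iff ξ).1 hξ).1).continuousOn.domRestrict).const_smul ε⁻¹
  refine ⟨D, fun ξ₁ h₁ ξ₂ h₂ => ?_, Subset.antisymm ?_ ?_⟩
  · rw [s.secondVariation_eq_integral_hessOp g h₁ h₂]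
    refine integral_congr_ae ?_
    filter_upwards [hD ξ₁ h₁] with t ht
    exact hP.apply_inv_smul.symm.trans (congrArg₂ P ht.symm
      (fieldExt_coe (J := cotI n) (x := zeroCov q) ξ₂ t))
  · rintro η ⟨hcoker, hann⟩
    refine (Lp.eq_zero_iff_ae_eq_zero).2 (hP.ae_eq_zero_of_cokernel hG (V := V)
      ((Lp.memLp η).integrable (by norm_num)) (fun ζ hζ => ?_) fun v hv => ?_)
    · have hξ := s.fieldOf_mem_pathTangent hζ
      refine Eq.trans (integral_congr_ae ?_) (hcoker _ hξ)
      filter_upwards [hD _ hξ] with t ht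
      rw [sasaki_eq, ht, ← hessOp_congr (fieldExt_fieldOf q ζ)]
      rfl
    · exact hann (fieldOf q fun _ => (v, 0))
        ((s.mem_familyTangent_iff g _).2 ⟨v, hv, fieldExt_fieldOf q _⟩)
  · rintro η rfl
    have hzero := Lp.coeFn_zero (CotModel n) 2 (volume : Measure I)
    refine ⟨fun ξ _ => integral_eq_zero_of_ae ?_, fun ξ _ => integral_eq_zero_of_ae ?_⟩
    · filter_upwards [hzero] with t ht
      rw [sasaki_eq, ht]
      exact map_zero _
    · filter_upwards [hzero] with t ht
      rw [ht]
      exact (hP.eq_linSasaki _ 0).trans (map_zero _)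

theorem isBottNondegenerateAt :
    IsBottNondegenerateAt g (conormal T) (constChords g (conormal T)) q := by
  refine ⟨_, s.isHessian g, s.hessianKernel_eq g,
    s.exists_operator g (isScalarProduct_metricEquiv g q).isSasakiPairing_symplectic, ?_⟩
  have hsasaki : sasaki g q = fun x y => linSasaki (metricEquiv g q) x y :=
    funext₂ (sasaki_eq g q)
  rw [hsasaki]
  exact s.exists_operator g (isSasakiPairing_linSasaki _)

end SliceChart

end Nondegenerate

end ConormalChords

end

theorem mainTheorem10_general {n k : ℕ} {N : Type*} [TopologicalSpace N]
    [ChartedSpace (Model n) N] [IsManifold (𝓡 n) ∞ N] (g : RiemMetric n N) {T : Set N}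
    (hT : IsSubmanifold n k T) :
    constChords g (conormal T) = {γ | ∃ q ∈ T, ∀ t, γ t = zeroCov q} ∧
    IsDiffeoOnto T (constChords g (conormal T)) (constPath n) ∧
    ∀ q ∈ T, IsBottNondegenerateAt g (conormal T) (constChords g (conormal T)) q := by
  refine ⟨constChords_conormal g T, isDiffeoOnto_constPath g T, fun q hq => ?_⟩
  obtain ⟨V, ⟨s⟩⟩ := hT.exists_sliceChart hq
  exact s.isBottNondegenerateAt g

theorem mainTheorem10 (n k : ℕ) (hk : k ≤ n)
    (N : Type*) [TopologicalSpace N] [T2Space N] [SecondCountableTopology N]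
    [ChartedSpace (Model n) N] [IsManifold (𝓡 n) ∞ N]
    (g : RiemMetric n N)
    (T : Set N) (hT : IsSubmanifold n k T) (hTc : IsCompact T) :
    constChords g (conormal T) = {γ | ∃ q ∈ T, ∀ t, γ t = zeroCov q} ∧
    IsDiffeoOnto T (constChords g (conormal T)) (constPath n) ∧
    ∀ q ∈ T, IsBottNondegenerateAt g (conormal T) (constChords g (conormal T)) q :=
  mainTheorem10_general g hT
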